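/- **Setting.** Let $d,r,N,\tau,L$ be positive integers. Tasks $\theta_1,\dots,\theta_\tau\in\mathbb R^d$ are played one after the other, each for $N$ rounds. If the agent takes the action $x$, $\|x\|\le 1$, in round $t$ of task $s$, it receives the reward $x^\top\theta_s+\eta_{s,t}$, where the noise variables $\eta_{s,t}$ are independent and $1$-sub-Gaussian ($\mathbb E e^{\lambda\eta_{s,t}}\le e^{\lambda^2/2}$ for all real $\lambda$). There are an unknown matrix $B\in\mathbb R^{d\times r}$ with orthonormal columns and vectors $\alpha_s\in\mathbb R^r$ with $\theta_s=B\alpha_s$, and $\phi_{\min}\le\|\theta_s\|\le\phi_{\max}$ for all $s$. Write $g(v)$ for a maximizer of $x\mapsto x^\top v$ over the unit ball $\{x\in\mathbb R^d:\|x\|\le 1\}$. The regret is $R_{\tau N}=\sum_{s=1}^{\tau}\sum_{t=1}^{N}(g(\theta_s)-x_{s,t})^\top\theta_s$, where $x_{s,t}$ is the action taken. **Algorithm (SeqRepL).** Cycle $n=1,2,\dots$ consists of $L$ tasks played with RE followed by $nL$ tasks played with RT; play stops after $\tau$ tasks. * RE: for $N_1=\lceil d\sqrt N\rceil$ rounds,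 take cyclically the vectors of an arbitrary orthonormal basis of $\mathbb R^d$; with $X$ the matrix of these actions and $Y$ the vector of their rewards, let $\hat\theta=(XX^\top)^{-1}XY$; take $g(\hat\theta)$ in the remaining rounds. * After the RE phase of a cycle, let $\hat P=\sum_i\hat\theta_i\hat\theta_i^\top$, summed over all tasks played with RE so far, and let $\hat B\in\mathbb R^{d\times r}$ consist of (left) singular vectors of $\hat P$ for its $r$ largest singular values. * RT: for $N_2=\lceil r\sqrt N\rceil$ rounds, take cyclically the vectors of an arbitrary orthonormal basis of the column space of $\hat B$; with $X,Y$ the actions and rewards of these rounds, let $\hat\alpha=(\hat B^\top XX^\top\hat B)^{-1}\hat B^\top XY$ and $\hat\theta=\hat B\hat\alpha$; take $g(\hat\theta)$ in the remaining rounds. **Theorem.** There is an integer $k\ge 0$ such that for all constants $0<\phi_{\min}\le\phi_{\max}$, $\nu>0$ and $c_1>0$ there is a constant $C>0$ with the following property. In the setting above let $L=c_1r$ be an integer, $\tau>r^2$ and $N\ge d^2$, and suppose that for every window of $L$ consecutive tasks the matrix $W_s=[\theta_{s+1},\dots,\theta_{s+L}]$, $0\le s\le\tau-L$, satisfies $\sigma_r(W_sW_s^\top)\ge\nu$,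 where $\sigma_r$ denotes the $r$-th largest singular value. Then the regret of SeqRepL satisfies $$\mathbb E R_{\tau N}\le C\left(d\sqrt{\tau rN}+\tau r\sqrt N\right)\log^k(\tau N).$$ That is, $\mathbb E R_{\tau N}=\tilde O\left(d\sqrt{\tau rN}+\tau r\sqrt N\right)$. -/

import Mathlib

open MeasureTheory ProbabilityTheory
open scoped Matrix BigOperators

noncomputable section

namespace SeqBandit

/-- Actions, task coefficients and their estimates live in `ℝ^d` with the Euclidean norm. -/
abbrev Vec (d : ℕ) : Type := EuclideanSpace ℝ (Fin d)

/-- The action set: the closed unit ball centered at the origin. -/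
def actionSet (d : ℕ) : Set (Vec d) := Metric.closedBall 0 1

/-- `x` maximizes `x ↦ xᵀ v` over the action set. -/
def IsGreedyAction {d : ℕ} (v x : Vec d) : Prop :=
  x ∈ actionSet d ∧ IsMaxOn (fun z : Vec d => inner ℝ z v) (actionSet d) x

/-- The columns of `Bhat` are left singular vectors of `P` associated with its `r` largest
singular values: in some singular value decomposition `P = U Σ Vᵀ` with nonincreasing singular
values, `Bhat` consists of the first `r` columns of `U`. -/
def IsTopSingularVectors {d r : ℕ} (P : Matrix (Fin d) (Fin d) ℝ)
    (Bhat : Matrix (Fin d) (Fin r) ℝ) : Prop :=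
  ∃ (h : r ≤ d) (U V : Matrix (Fin d) (Fin d) ℝ) (σ : Fin d → ℝ),
    Uᵀ * U = 1 ∧ Vᵀ * V = 1 ∧ Antitone σ ∧ (∀ i, 0 ≤ σ i) ∧
    P = U * Matrix.diagonal σ * Vᵀ ∧
    ∀ i j, Bhat i j = U i (Fin.castLE h j)

/-- The `j`-th column of a `d × k` matrix, as a Euclidean vector. -/
def colVec {d k : ℕ} (A : Matrix (Fin d) (Fin k) ℝ) (j : Fin k) : Vec d :=
  WithLp.toLp 2 (fun i => A i j)

/-- The points that the pseudocode leaves open, fixed in an arbitrary (Borel measurable) way: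
the orthonormal basis of `ℝ^d` explored in a task played with RE, the choice of the top `r`
singular vectors, the orthonormal basis of `span Bhat` explored in a task played with RT,
and the choice of a maximizer over the action set. -/
structure Rules (d r : ℕ) where
  /-- the basis `a_1, …, a_d` used by RE in a given task -/
  reBasis : ℕ → OrthonormalBasis (Fin d) ℝ (Vec d)
  /-- the top `r` singular vectors of a matrix -/
  topVectors : Matrix (Fin d) (Fin d) ℝ → Matrix (Fin d) (Fin r) ℝ
  /-- the basis `a'_1, …, a'_r` of `span Bhat` used by RT in a given task -/
  rtBasis : ℕ → Matrix (Fin d) (Fin r) ℝ → Fin r → Vec d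
  /-- a maximizer of `x ↦ xᵀ v` over the action set -/
  greedy : Vec d → Vec d
  topVectors_spec : ∀ P, IsTopSingularVectors P (topVectors P)
  rtBasis_orthonormal : ∀ s Bhat, Bhatᵀ * Bhat = 1 → Orthonormal ℝ (rtBasis s Bhat)
  rtBasis_span : ∀ s Bhat, Bhatᵀ * Bhat = 1 →
    Submodule.span ℝ (Set.range (rtBasis s Bhat)) =
      Submodule.span ℝ (Set.range (colVec Bhat))
  greedy_spec : ∀ v, IsGreedyAction v (greedy v)
  topVectors_measurable : ∀ i j,
    Measurable (fun P : Fin d → Fin d → ℝ => topVectors (Matrix.of P) i j)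
  rtBasis_measurable : ∀ s j,
    Measurable (fun Bhat : Fin d → Fin r → ℝ => rtBasis s (Matrix.of Bhat) j)
  greedy_measurable : Measurable greedy

/-- Cyclic exploration: in round `t = 0, 1, …` take the `(t mod k)`-th vector of the family. -/
def cyclicAction {d k : ℕ} (a : Fin k → Vec d) (t : ℕ) : Vec d :=
  if h : 0 < k then a ⟨t % k, Nat.mod_lt t h⟩ else 0

/-- The matrix `[x_1, …, x_M]` of the first `M` actions of a task. -/
def actionMatrix {d : ℕ} (x : ℕ → Vec d) (M : ℕ) : Matrix (Fin d) (Fin M) ℝ :=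
  Matrix.of fun i t => x t i

/-- The vector `[y_1, …, y_M]ᵀ` of the first `M` rewards `y_t = x_tᵀ θ + η_t` of a task. -/
def rewardVector {d : ℕ} (x : ℕ → Vec d) (θ : Vec d) (η : ℕ → ℝ) (M : ℕ) : Fin M → ℝ :=
  fun t => inner ℝ (x t) θ + η t

/-- Exploration length `N₁ = ⌈d √N⌉` of RE. -/
def reLength (d N : ℕ) : ℕ := ⌈(d : ℝ) * √(N : ℝ)⌉₊

/-- Exploration length `N₂ = ⌈r √N⌉` of RT. -/
def rtLength (r N : ℕ) : ℕ := ⌈(r : ℝ) * √(N : ℝ)⌉₊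

/-- The estimate `(X Xᵀ)⁻¹ X Y` computed by RE from the exploration rounds of a task `θ` with
noise `η`, where `a` is the explored basis. -/
def reEstimate {d : ℕ} (a : Fin d → Vec d) (θ : Vec d) (η : ℕ → ℝ) (N : ℕ) : Vec d :=
  let X := actionMatrix (cyclicAction a) (reLength d N)
  let Y := rewardVector (cyclicAction a) θ η (reLength d N)
  WithLp.toLp 2 ((X * Xᵀ)⁻¹ *ᵥ (X *ᵥ Y))

/-- The estimate `Bhat αhat`, `αhat = (Bhatᵀ X Xᵀ Bhat)⁻¹ Bhatᵀ X Y`, computed by RT from the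
exploration rounds of a task `θ` with noise `η`, where `a` is the explored basis of `span Bhat`. -/
def rtEstimate {d r : ℕ} (Bhat : Matrix (Fin d) (Fin r) ℝ) (a : Fin r → Vec d) (θ : Vec d)
    (η : ℕ → ℝ) (N : ℕ) : Vec d :=
  let X := actionMatrix (cyclicAction a) (rtLength r N)
  let Y := rewardVector (cyclicAction a) θ η (rtLength r N)
  WithLp.toLp 2 (Bhat *ᵥ ((Bhatᵀ * X * Xᵀ * Bhat)⁻¹ *ᵥ ((Bhatᵀ * X) *ᵥ Y)))

/-- Number of tasks played before the cycle with (zero-based) index `n`: that cycle consists of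
`L` tasks played with RE, followed by `(n + 1) L` tasks played with RT. -/
def cycleStart (L : ℕ) : ℕ → ℕ
  | 0 => 0
  | n + 1 => cycleStart L n + (L + (n + 1) * L)

/-- The (zero-based) index of the cycle to which the task `s` belongs (for `1 ≤ L`). -/
def cycleOf (L s : ℕ) : ℕ := Nat.findGreatest (fun n => cycleStart L n ≤ s) s

/-- Task `s` belongs to the RE phase of its cycle. -/
def InREPhase (L s : ℕ) : Prop := s < cycleStart L (cycleOf L s) + L

section Algorithm

variable {d r : ℕ} (ρ : Rules d r) (L N : ℕ) (θ : ℕ → Vec d) (η : ℕ → ℕ → ℝ)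

/-- The matrix `Phat = ∑ θhat_i θhat_iᵀ` after the RE phase of cycle `n`; the sum runs over all
tasks in the RE phases of the cycles `0, …, n`. -/
def pHat (n : ℕ) : Matrix (Fin d) (Fin d) ℝ :=
  ∑ m ∈ Finset.range (n + 1), ∑ j ∈ Finset.range L,
    let s := cycleStart L m + j
    let v := reEstimate (ρ.reBasis s) (θ s) (η s) N
    Matrix.vecMulVec v v

/-- The representation estimate `Bhat` used in the RT phase of cycle `n`. -/
def bHat (n : ℕ) : Matrix (Fin d) (Fin r) ℝ := ρ.topVectors (pHat ρ L N θ η n)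

/-- The action taken by SeqRepL in round `t` of task `s` (both counted from `0`), when the tasks
are `θ` and the realization of the noise is `η`. -/
def action (s t : ℕ) : Vec d :=
  open Classical in
  if InREPhase L s then
    if t < reLength d N then cyclicAction (ρ.reBasis s) t
    else ρ.greedy (reEstimate (ρ.reBasis s) (θ s) (η s) N)
  else
    let Bhat := bHat ρ L N θ η (cycleOf L s)
    if t < rtLength r N then cyclicAction (ρ.rtBasis s Bhat) t
    else ρ.greedy (rtEstimate Bhat (ρ.rtBasis s Bhat) (θ s) (η s) N)

/-- The regret of SeqRepL over the first `τ` tasks, each played for `N` rounds, with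
`x* = ρ.greedy (θ s)` the optimal action for task `s`. -/
def regret (τ : ℕ) : ℝ :=
  ∑ s ∈ Finset.range τ, ∑ t ∈ Finset.range N,
    inner ℝ (ρ.greedy (θ s) - action ρ L N θ η s t) (θ s)

end Algorithm

/-- The matrix `W_s = [θ_s, …, θ_{s+L-1}]` of a window of `L` consecutive tasks. -/
def windowMatrix {d : ℕ} (θ : ℕ → Vec d) (s L : ℕ) : Matrix (Fin d) (Fin L) ℝ :=
  Matrix.of fun i j => θ (s + j) i

/-- The `r`-th largest singular value (`1 ≤ r`) of a square matrix. -/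
def singularValue {d : ℕ} (r : ℕ) (A : Matrix (Fin d) (Fin d) ℝ) : ℝ :=
  (Matrix.toEuclideanLin A).singularValues (r - 1)

end SeqBandit

end

/-! Greedy play on the unit ball loses only to second order: acting on an estimate `v` of `θ` costs
at most `2‖v - θ‖² / ‖θ‖` per round. Exploring `k` orthonormal directions for about `k√N` rounds
leaves a mean squared noise of order `k/√N`, so exploration and exploitation both cost order `k√N`.
This settles RE (`k = d`). For RT (`k = r`) there remains the part `q` of `θ_s` orthogonal to the
span of `Bhat`.

To bound `q`, let `S` be the column space of `B` and write the RE estimates as `θ_i + e_i`. On `Sᗮ`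
the form of `Phat` is the noise form `∑ ⟨e_i, ·⟩²`, at most `K‖·‖²`. As `dim S ≤ r`, Courant–Fischer
carries this bound over to vectors orthogonal to `Bhat` (`form_le_of_orthogonal_top`), in particular
to `q`. Hence `∑ ⟨θ_i, q⟩² ≤ 4K‖q‖²`, whereas diversity makes this Gram form at least `(n+1)ν` on
`S`; since `‖q‖² = ⟨q, θ_s⟩`, it follows that `(n+1)ν‖q‖² ≤ 4K‖θ_s‖²` (`mul_norm_sq_le_of_gram`).
Only the noise Gram form has to be estimated, with no cross terms and no perturbation theorem for
subspaces. A net argument (`exists_event_gram_le`) gives `K` of order `((n+1)L + d)/√N`, up to a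
logarithm, so an RT task in cycle `n` costs order `√N (r + L + d/(n+1))`.

With weight `1` for RE tasks and `1/(n+1)` for RT tasks, each cycle has total weight `2L`. About
`√(τ/L)` cycles are played, so the terms in `d` add up to order `d√N √(τL)`, and `L = c₁ r`. -/

noncomputable section

namespace SeqBandit

/-! ### Quadratic forms, singular values and almost orthogonality. -/

section LinearAlgebra

variable {E : Type*} [NormedAddCommGroup E] [InnerProductSpace ℝ E]

/-- For `σ > 0` the vector `T u - σ u` is sent by `T` to its multiple by `-σ`, which positivity
forbids unless it vanishes. This turns singular vectors of a positive operator into eigenvectors. -/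
lemma apply_eq_smul_of_apply_apply_eq {T : E →ₗ[ℝ] E} (hT : T.IsSymmetric)
    (hpos : ∀ x, 0 ≤ inner ℝ x (T x)) {u : E} {σ : ℝ} (hσ : 0 ≤ σ)
    (h : T (T u) = σ ^ 2 • u) : T u = σ • u := by
  rcases hσ.eq_or_lt with rfl | hσ
  · have : inner ℝ (T u) (T u) = 0 := by
      rw [hT u (T u), h]; simp
    simpa using this
  · have h1 : T (T u - σ • u) = -(σ • (T u - σ • u)) := by
      rw [map_sub, h, map_smul, smul_sub, smul_smul, sq]; abel
    have h2 := hpos (T u - σ • u)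
    rw [h1, inner_neg_right, inner_smul_right, real_inner_self_eq_norm_sq] at h2
    have h3 : ‖T u - σ • u‖ ^ 2 ≤ 0 := by nlinarith [sq_nonneg ‖T u - σ • u‖]
    have h4 : ‖T u - σ • u‖ = 0 := by nlinarith [sq_nonneg ‖T u - σ • u‖]
    exact sub_eq_zero.mp (norm_eq_zero.mp h4)

lemma inner_apply_eq_sum_of_eigenbasis {ι : Type*} [Fintype ι] {T : E →ₗ[ℝ] E}
    (u : OrthonormalBasis ι ℝ E) {σ : ι → ℝ} (h : ∀ i, T (u i) = σ i • u i) (v : E) :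
    inner ℝ v (T v) = ∑ i, σ i * inner ℝ (u i) v ^ 2 := by
  have h1 : T v = ∑ i, (σ i * inner ℝ (u i) v) • u i := by
    conv_lhs => rw [← u.sum_repr' v]
    rw [map_sum]
    refine Finset.sum_congr rfl fun i _ => ?_
    rw [map_smul, h, smul_smul, mul_comm]
  rw [h1, inner_sum]
  refine Finset.sum_congr rfl fun i _ => ?_
  rw [inner_smul_right, real_inner_comm]; ring

/-- Courant–Fischer: if a quadratic form is at most `K` on the orthogonal complement of a
subspace of dimension at most `r`, then it is at most `K` on the orthogonal complement of its
top `r` eigenvectors. -/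
lemma form_le_of_orthogonal_top {d r : ℕ} (hrd : r ≤ d) (u : OrthonormalBasis (Fin d) ℝ E)
    {σ : Fin d → ℝ} (hσ : Antitone σ) (S : Submodule ℝ E)
    (hS : Module.finrank ℝ S ≤ r) {K : ℝ}
    (hK : ∀ w ∈ Sᗮ, ∑ i, σ i * inner ℝ (u i) w ^ 2 ≤ K * ‖w‖ ^ 2) {v : E}
    (hv : ∀ j : Fin r, inner ℝ (u (Fin.castLE hrd j)) v = 0) :
    ∑ i, σ i * inner ℝ (u i) v ^ 2 ≤ K * ‖v‖ ^ 2 := by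
  have : FiniteDimensional ℝ E := u.toBasis.finiteDimensional_of_finite
  have hv' : ∀ i : Fin d, (i : ℕ) < r → inner ℝ (u i) v = 0 := fun i hi => hv ⟨i, hi⟩
  rw [← u.sum_sq_inner_right v, Finset.mul_sum]
  refine Finset.sum_le_sum fun i _ => ?_
  rcases lt_or_ge (i : ℕ) r with hi | hi
  · rw [hv' i hi]; simp
  refine mul_le_mul_of_nonneg_right ?_ (sq_nonneg _)
  have hlt : r < d := lt_of_le_of_lt hi i.2
  -- The projection to `S` of the span of the first `r + 1` eigenvectors has a kernel. A nonzero `w`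
  -- in it lies in `Sᗮ`, and its form is at least `σ i ‖w‖²` because `i ≥ r`; so `σ i ≤ K`.
  let f : (Fin (r + 1) → ℝ) →ₗ[ℝ] S :=
    S.orthogonalProjectionOnto.toLinearMap ∘ₗ
      (Fintype.linearCombination ℝ (fun j : Fin (r + 1) => u (Fin.castLE hlt j)))
  have hker : LinearMap.ker f ≠ ⊥ := by
    apply LinearMap.ker_ne_bot_of_finrank_lt
    simp; omega
  obtain ⟨z, hz, hz0⟩ := Submodule.exists_mem_ne_zero_of_ne_bot hker
  let w : E := ∑ j : Fin (r + 1), z j • u (Fin.castLE hlt j)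
  have hw : w ∈ Sᗮ := by
    rw [← Submodule.orthogonalProjectionOnto_eq_zero_iff]
    simpa [f, w, Fintype.linearCombination_apply] using hz
  have hco : ∀ k : Fin d, inner ℝ (u k) w = if h : (k : ℕ) < r + 1 then z ⟨k, h⟩ else 0 := by
    intro k
    simp only [w, inner_sum, inner_smul_right, OrthonormalBasis.inner_eq_ite]
    split_ifs with h
    · rw [Finset.sum_eq_single ⟨k, h⟩]
      · simp
      · intro j _ hj
        rw [if_neg, mul_zero]
        rintro rfl
        exact hj rfl
      · simp
    · refine Finset.sum_eq_zero fun j _ => ?_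
      rw [if_neg, mul_zero]
      rintro rfl
      exact h j.2
  have hw0 : 0 < ‖w‖ ^ 2 := by
    have : w ≠ 0 := by
      intro h0
      apply hz0
      ext j
      have := hco (Fin.castLE hlt j)
      rw [h0, inner_zero_right] at this
      simpa [Nat.lt_succ_iff.mp j.2] using this.symm
    positivity
  have h1 : σ i * ‖w‖ ^ 2 ≤ ∑ k, σ k * inner ℝ (u k) w ^ 2 := by
    rw [← u.sum_sq_inner_right w, Finset.mul_sum]
    refine Finset.sum_le_sum fun k _ => ?_
    by_cases h : (k : ℕ) < r + 1
    · refine mul_le_mul_of_nonneg_right (hσ ?_) (sq_nonneg _)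
      exact Fin.le_def.mpr (by omega)
    · rw [hco k, dif_neg h]; simp
  exact le_of_mul_le_mul_right (h1.trans (hK w hw)) hw0

/-- The eigenvectors of the `r` largest eigenvalues are images under `T` up to nonzero factors, so
they lie in `S`; by dimension they span it. -/
lemma mul_norm_sq_le_inner_of_singularValues [FiniteDimensional ℝ E] {T : E →ₗ[ℝ] E}
    (hT : T.IsSymmetric) (hpos : ∀ x, 0 ≤ inner ℝ x (T x)) (S : Submodule ℝ E)
    (hTS : ∀ x, T x ∈ S) {r : ℕ} (hr : 1 ≤ r) (hS : Module.finrank ℝ S ≤ r) {ν : ℝ}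
    (hν : 0 < ν) (h : ν ≤ T.singularValues (r - 1)) {z : E} (hz : z ∈ S) :
    ν * ‖z‖ ^ 2 ≤ inner ℝ z (T z) := by
  have hadj : LinearMap.adjoint T = T := by
    rw [← LinearMap.isSelfAdjoint_iff']
    exact (LinearMap.isSymmetric_iff_isSelfAdjoint T).mp hT
  set n := Module.finrank ℝ E with hn
  let u := T.isSymmetric_adjoint_comp_self.eigenvectorBasis hn.symm
  have hu : ∀ i, T (u i) = T.singularValues i • u i := by
    intro i
    apply apply_eq_smul_of_apply_apply_eq hT hpos (T.singularValues_nonneg _)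
    have := T.isSymmetric_adjoint_comp_self.apply_eigenvectorBasis hn.symm i
    rw [LinearMap.comp_apply] at this
    rw [T.sq_singularValues_fin hn.symm i]
    exact (LinearMap.congr_fun hadj (T (u i))).symm.trans this
  -- Singular values beyond the dimension are `0` by convention, which `0 < ν` excludes.
  have hrn : r ≤ n := by
    by_contra hc
    rw [T.singularValues_of_finrank_le (by omega)] at h
    linarith
  have hsv : ∀ i : Fin n, (i : ℕ) < r → ν ≤ T.singularValues i := fun i hi =>
    h.trans (T.singularValues_antitone (by omega))
  have hmem : ∀ i : Fin r, u (Fin.castLE hrn i) ∈ S := by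
    intro i
    have h1 := hsv (Fin.castLE hrn i) i.2
    have h2 := S.smul_mem (T.singularValues (Fin.castLE hrn i))⁻¹ (hTS (u (Fin.castLE hrn i)))
    rwa [hu, smul_smul, inv_mul_cancel₀ (by linarith), one_smul] at h2
  have hspan : Submodule.span ℝ (Set.range fun i : Fin r => u (Fin.castLE hrn i)) = S := by
    apply Submodule.eq_of_le_of_finrank_le
    · rw [Submodule.span_le]
      rintro _ ⟨i, rfl⟩
      exact hmem i
    · rw [finrank_span_eq_card]
      · simpa using hS
      · exact (u.orthonormal.linearIndependent).comp _ (Fin.castLE_injective hrn)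
  have hzero : ∀ i : Fin n, r ≤ (i : ℕ) → inner ℝ (u i) z = 0 := by
    intro i hi
    rw [← hspan] at hz
    induction hz using Submodule.span_induction with
    | mem x hx =>
      obtain ⟨j, rfl⟩ := hx
      apply u.orthonormal.2
      intro hij
      have := congrArg Fin.val hij
      have := j.2
      simp at *
      omega
    | zero => simp
    | add x y _ _ hx hy => rw [inner_add_right, hx, hy, add_zero]
    | smul a x _ hx => rw [inner_smul_right, hx, mul_zero]
  rw [inner_apply_eq_sum_of_eigenbasis u hu, ← u.sum_sq_inner_right z, Finset.mul_sum]
  refine Finset.sum_le_sum fun i _ => ?_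
  rcases lt_or_ge (i : ℕ) r with hi | hi
  · exact mul_le_mul_of_nonneg_right (hsv i hi) (sq_nonneg _)
  · rw [hzero i hi]; simp

/-- A vector orthogonal to a subspace on which the perturbed Gram form `∑ ⟨x_i + e_i, ·⟩²` is
large is almost orthogonal to the vectors that the unperturbed Gram form controls. -/
lemma mul_norm_sq_le_of_gram {ι : Type*} [Fintype ι] (S : Submodule ℝ E)
    [S.HasOrthogonalProjection] {x e : ι → E} (hx : ∀ i, x i ∈ S) {K lam : ℝ} (hK : 0 ≤ K)
    (hlam : 0 ≤ lam)
    (hS : ∀ z ∈ S, lam * ‖z‖ ^ 2 ≤ ∑ i, inner ℝ (x i) z ^ 2) {q y : E}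
    (he : ∑ i, inner ℝ (e i) q ^ 2 ≤ K * ‖q‖ ^ 2)
    (hxe : ∑ i, inner ℝ (x i + e i) q ^ 2 ≤ K * ‖q‖ ^ 2) (hy : y ∈ S)
    (hq : inner ℝ q y = ‖q‖ ^ 2) : lam * ‖q‖ ^ 2 ≤ 4 * K * ‖y‖ ^ 2 := by
  set z : E := S.starProjection q with hz
  have hzS : z ∈ S := S.starProjection_apply_mem q
  have hin : ∀ w ∈ S, inner ℝ w q = inner ℝ w z := by
    intro w hw
    have := S.starProjection_inner_eq_zero q w hw
    rw [inner_sub_left, sub_eq_zero, real_inner_comm, real_inner_comm w] at this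
    exact this
  -- The `x i` lie in `S` and do not distinguish `q` from its projection `z`; then `a² ≤ 2(a + b)² +
  -- 2b²`.
  have h1 : lam * ‖z‖ ^ 2 ≤ 4 * K * ‖q‖ ^ 2 := by
    calc lam * ‖z‖ ^ 2 ≤ ∑ i, inner ℝ (x i) z ^ 2 := hS z hzS
      _ = ∑ i, inner ℝ (x i) q ^ 2 := by simp_rw [hin _ (hx _)]
      _ ≤ ∑ i, (2 * inner ℝ (x i + e i) q ^ 2 + 2 * inner ℝ (e i) q ^ 2) := by
          refine Finset.sum_le_sum fun i _ => ?_
          rw [inner_add_left]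
          nlinarith [sq_nonneg (inner ℝ (x i) q + 2 * inner ℝ (e i) q)]
      _ ≤ 4 * K * ‖q‖ ^ 2 := by
          rw [Finset.sum_add_distrib, ← Finset.mul_sum, ← Finset.mul_sum]; linarith
  have h2 : ‖q‖ ^ 2 ≤ ‖z‖ * ‖y‖ := by
    rw [← hq, real_inner_comm, hin y hy, mul_comm]
    exact real_inner_le_norm _ _
  rcases eq_or_ne q 0 with h0 | h0
  · subst h0
    simp only [norm_zero, ne_eq, OfNat.ofNat_ne_zero, not_false_eq_true, zero_pow, mul_zero]
    positivity
  · have hq0 : 0 < ‖q‖ ^ 2 := by positivity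
    have h3 : (‖q‖ ^ 2) ^ 2 ≤ (‖z‖ * ‖y‖) ^ 2 := by gcongr
    have h4 : lam * ‖q‖ ^ 2 * ‖q‖ ^ 2 ≤ 4 * K * ‖y‖ ^ 2 * ‖q‖ ^ 2 := by
      nlinarith [mul_le_mul_of_nonneg_left h3 hlam,
        mul_le_mul_of_nonneg_right h1 (sq_nonneg ‖y‖)]
    exact le_of_mul_le_mul_right h4 hq0

end LinearAlgebra

/-- For `v ≠ 0` the equality case of Cauchy–Schwarz forces the action `v / ‖v‖`. For `v = 0` the
action is arbitrary and the trivial loss `2‖θ‖` suffices. -/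
lemma inner_greedy_sub_mul_norm_le {d : ℕ} {v θ x g : Vec d} (hx : IsGreedyAction v x)
    (hg : IsGreedyAction θ g) : inner ℝ (g - x) θ * ‖θ‖ ≤ 2 * ‖v - θ‖ ^ 2 := by
  have hx1 : ‖x‖ ≤ 1 := by simpa [actionSet] using hx.1
  have hg1 : ‖g‖ ≤ 1 := by simpa [actionSet] using hg.1
  have hgθ : inner ℝ g θ ≤ ‖θ‖ := by
    refine (real_inner_le_norm g θ).trans ?_
    nlinarith [norm_nonneg θ]
  have hxθ : -‖θ‖ ≤ inner ℝ x θ := by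
    have := (abs_le.mp (abs_real_inner_le_norm x θ)).1
    nlinarith [norm_nonneg θ]
  have hδ := norm_sub_sq_real v θ
  have hcs := real_inner_le_norm v θ
  have hcs' := (abs_le.mp (abs_real_inner_le_norm v θ)).1
  rw [inner_sub_left, hδ]
  set a := ‖θ‖
  rcases eq_or_ne v 0 with rfl | hv
  · simp; nlinarith [norm_nonneg θ]
  have hb : 0 < ‖v‖ := norm_pos_iff.mpr hv
  have hxv : ‖v‖ ≤ inner ℝ x v := by
    have h := hx.2 (show (‖v‖⁻¹ • v) ∈ actionSet d by
      simp [actionSet, norm_smul, inv_mul_cancel₀ hb.ne'])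
    simp only [Set.mem_ofPred_eq, inner_smul_left, real_inner_self_eq_norm_sq] at h
    have : ‖v‖⁻¹ * ‖v‖ ^ 2 = ‖v‖ := by field_simp
    simp at h
    linarith
  have heq : ‖v‖ • x = v := by
    have h := norm_sub_sq_real (‖v‖ • x) v
    rw [norm_smul, inner_smul_left, norm_norm] at h
    simp at h
    have : ‖‖v‖ • x - v‖ ^ 2 ≤ 0 := by
      rw [h]
      have : ‖x‖ ^ 2 ≤ 1 := by nlinarith [norm_nonneg x]
      nlinarith [mul_le_mul_of_nonneg_left this (sq_nonneg ‖v‖), mul_le_mul_of_nonneg_left hxv hb.le]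
    have h0 : ‖‖v‖ • x - v‖ = 0 := by nlinarith [sq_nonneg ‖‖v‖ • x - v‖]
    exact sub_eq_zero.mp (norm_eq_zero.mp h0)
  have hc : ‖v‖ * inner ℝ x θ = inner ℝ v θ := by
    conv_rhs => rw [← heq]
    rw [inner_smul_left]; simp
  set b := ‖v‖
  set c := inner ℝ v θ
  have ha : 0 ≤ a := norm_nonneg θ
  -- Here `‖v - θ‖² = (a - b)² + 2(ab - c)`. If `a ≤ 4b`, the second summand alone suffices;
  -- otherwise `ab - c ≤ 2ab` reduces the claim to `a² - 4ab ≤ (a - b)²`.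
  have key : a * (a * b - c) ≤ 2 * b * (b ^ 2 - 2 * c + a ^ 2) := by
    have he : 0 ≤ a * b - c := by nlinarith
    rcases le_or_gt a (4 * b) with h4 | h4
    · nlinarith [mul_nonneg hb.le (sq_nonneg (a - b)), mul_le_mul_of_nonneg_right h4 he]
    · have he2 : a * b - c ≤ 2 * (a * b) := by nlinarith
      nlinarith [mul_le_mul_of_nonneg_left he2 (by linarith : 0 ≤ a - 4 * b),
        mul_nonneg ha (sq_nonneg b), pow_pos hb 3]
  have : b * ((inner ℝ g θ - inner ℝ x θ) * a) ≤ b * (2 * (b ^ 2 - 2 * c + a ^ 2)) := by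
    calc b * ((inner ℝ g θ - inner ℝ x θ) * a) ≤ b * ((a - inner ℝ x θ) * a) := by gcongr
      _ = a * (a * b - c) := by rw [← hc]; ring
      _ ≤ _ := key
      _ = _ := by ring
  exact le_of_mul_le_mul_left this hb

/-! ### Nets of the unit ball and operator norms. -/

section Nets

/-- A 1-separated set of maximal cardinality in the ball of radius `2`, halved. The radius and
separation are those for which the Besicovitch packing bound gives `5 ^ dim`. -/
lemma exists_finset_half_net (E : Type*) [NormedAddCommGroup E] [NormedSpace ℝ E]
    [FiniteDimensional ℝ E] :
    ∃ s : Finset E, s.card ≤ 5 ^ Module.finrank ℝ E ∧ (∀ c ∈ s, ‖c‖ ≤ 1) ∧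
      ∀ x : E, ‖x‖ ≤ 1 → ∃ c ∈ s, ‖x - c‖ ≤ 1 / 2 := by
  classical
  let p : ℕ → Prop := fun n => ∃ s : Finset E, s.card = n ∧ (∀ c ∈ s, ‖c‖ ≤ 2) ∧
    ∀ c ∈ s, ∀ e ∈ s, c ≠ e → 1 ≤ ‖c - e‖
  have hp0 : p 0 := ⟨∅, by simp, by simp, by simp⟩
  obtain ⟨s, hs, hs2, hsep⟩ := Nat.findGreatest_spec (P := p) (Nat.zero_le (5 ^ Module.finrank ℝ E)) hp0
  have hcard : s.card ≤ 5 ^ Module.finrank ℝ E := by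
    rw [hs]; exact Nat.findGreatest_le _
  refine ⟨s.image fun c => (1 / 2 : ℝ) • c, Finset.card_image_le.trans hcard, ?_, ?_⟩
  · intro c hc
    obtain ⟨e, he, rfl⟩ := Finset.mem_image.mp hc
    rw [norm_smul]
    have := hs2 e he
    norm_num
    linarith
  · intro x hx
    by_contra! hcon
    have hx2 : ∀ c ∈ s, 1 < ‖(2 : ℝ) • x - c‖ := by
      intro c hc
      have h := hcon _ (Finset.mem_image_of_mem _ hc)
      have h2 : x - (1 / 2 : ℝ) • c = (1 / 2 : ℝ) • ((2 : ℝ) • x - c) := by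
        rw [smul_sub, smul_smul]; norm_num
      rw [h2, norm_smul] at h
      norm_num at h
      linarith
    have hnot : (2 : ℝ) • x ∉ s := fun h => by
      have := hx2 _ h
      simp at this
      linarith
    have hx2n : ‖(2 : ℝ) • x‖ ≤ 2 := by rw [norm_smul]; norm_num; linarith
    have hins1 : ∀ c ∈ insert ((2 : ℝ) • x) s, ‖c‖ ≤ 2 := by
      intro c hc
      rcases Finset.mem_insert.mp hc with rfl | hc
      · exact hx2n
      · exact hs2 c hc
    have hins2 : ∀ c ∈ insert ((2 : ℝ) • x) s, ∀ e ∈ insert ((2 : ℝ) • x) s, c ≠ e →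
        1 ≤ ‖c - e‖ := by
      intro c hc e he hce
      rcases Finset.mem_insert.mp hc with rfl | hc <;> rcases Finset.mem_insert.mp he with rfl | he
      · exact absurd rfl hce
      · exact (hx2 e he).le
      · rw [norm_sub_rev]; exact (hx2 c hc).le
      · exact hsep c hc e he hce
    have hpn : p (insert ((2 : ℝ) • x) s).card := ⟨_, rfl, hins1, hins2⟩
    have := Nat.le_findGreatest (Besicovitch.card_le_of_separated _ hins1 hins2) hpn
    rw [← hs, Finset.card_insert_of_notMem hnot] at this
    omega

/-- Each of the two nets costs a factor `2`: first `‖T x‖ ≤ 2t` for `x` in the net, then `‖T‖ ≤ 2t +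
‖T‖/2`. -/
lemma opNorm_le_four_mul_of_net {E F : Type*} [NormedAddCommGroup E] [NormedSpace ℝ E]
    [NormedAddCommGroup F] [InnerProductSpace ℝ F] (T : E →L[ℝ] F) {sE : Finset E}
    {sF : Finset F} (hE : ∀ x : E, ‖x‖ ≤ 1 → ∃ c ∈ sE, ‖x - c‖ ≤ 1 / 2)
    (hF : ∀ x : F, ‖x‖ ≤ 1 → ∃ c ∈ sF, ‖x - c‖ ≤ 1 / 2) {t : ℝ} (ht : 0 ≤ t)
    (h : ∀ x ∈ sE, ∀ y ∈ sF, inner ℝ y (T x) ≤ t) : ‖T‖ ≤ 4 * t := by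
  have h1 : ∀ x ∈ sE, ‖T x‖ ≤ 2 * t := by
    intro x hx
    rcases eq_or_ne (T x) 0 with h0 | h0
    · rw [h0, norm_zero]; positivity
    have hpos : 0 < ‖T x‖ := norm_pos_iff.mpr h0
    obtain ⟨y, hy, hyd⟩ := hF (‖T x‖⁻¹ • T x) (by
      rw [norm_smul, norm_inv, norm_norm, inv_mul_cancel₀ hpos.ne'])
    have e1 : inner ℝ (‖T x‖⁻¹ • T x) (T x) = ‖T x‖ := by
      rw [inner_smul_left, real_inner_self_eq_norm_sq]
      simp; field_simp
    have e2 : inner ℝ (‖T x‖⁻¹ • T x) (T x) =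
        inner ℝ y (T x) + inner ℝ (‖T x‖⁻¹ • T x - y) (T x) := by rw [inner_sub_left]; ring
    have e3 := real_inner_le_norm (‖T x‖⁻¹ • T x - y) (T x)
    have e4 := h x hx y hy
    nlinarith
  have h2 : ‖T‖ ≤ 2 * t + ‖T‖ / 2 := by
    refine ContinuousLinearMap.opNorm_le_of_unit_norm (by positivity) fun x hx => ?_
    obtain ⟨c, hc, hcd⟩ := hE x hx.le
    calc ‖T x‖ = ‖T c + T (x - c)‖ := by rw [map_sub]; congr 1; abel
      _ ≤ ‖T c‖ + ‖T (x - c)‖ := norm_add_le _ _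
      _ ≤ 2 * t + ‖T‖ * ‖x - c‖ := add_le_add (h1 c hc) (T.le_opNorm _)
      _ ≤ 2 * t + ‖T‖ / 2 := by nlinarith [norm_nonneg T]
  linarith

end Nets

/-! ### Sub-Gaussian averages and concentration of the noise Gram form. -/

section Probability

variable {Ω : Type*} [MeasurableSpace Ω] {μ : Measure Ω}

lemma hasSubgaussianMGF_mono {X : Ω → ℝ} {c c' : NNReal} (h : HasSubgaussianMGF X c μ)
    (hc : c ≤ c') : HasSubgaussianMGF X c' μ where
  integrable_exp_mul := h.integrable_exp_mul
  mgf_le t := (h.mgf_le t).trans (by gcongr)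

lemma one_add_sq_div_two_le_cosh (y : ℝ) : 1 + y ^ 2 / 2 ≤ Real.cosh y := by
  have h1 : (y / 2) ^ 2 ≤ Real.sinh (y / 2) ^ 2 := by
    rcases le_total 0 (y / 2) with h | h
    · have := Real.self_le_sinh_iff.mpr h
      nlinarith
    · have := Real.sinh_le_self_iff.mpr h
      nlinarith
  have h2 := Real.cosh_two_mul (y / 2)
  rw [mul_div_cancel₀ y two_ne_zero, Real.cosh_sq] at h2
  linarith

/-- Integrate `(lX)² ≤ e^{lX} + e^{-lX} - 2` at `l = c^{-1/2}`: the right side has mean at most `2√e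
- 2 ≤ 2`. -/
lemma integral_sq_le_of_hasSubgaussianMGF [IsProbabilityMeasure μ] {X : Ω → ℝ} {c : NNReal}
    (h : HasSubgaussianMGF X c μ) (hc : 0 < c) :
    Integrable (fun ω => X ω ^ 2) μ ∧ ∫ ω, X ω ^ 2 ∂μ ≤ 2 * c := by
  have hint : Integrable (fun ω => X ω ^ 2) μ := (h.memLp 2).integrable_sq
  refine ⟨hint, ?_⟩
  have hc' : (0 : ℝ) < c := hc
  set l : ℝ := (√(c : ℝ))⁻¹ with hl
  have hl2 : l ^ 2 = (c : ℝ)⁻¹ := by rw [hl, inv_pow, Real.sq_sqrt hc'.le]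
  have hpt : ∀ ω, l ^ 2 * X ω ^ 2 ≤ Real.exp (l * X ω) + Real.exp (-l * X ω) - 2 := by
    intro ω
    have := one_add_sq_div_two_le_cosh (l * X ω)
    rw [Real.cosh_eq] at this
    rw [neg_mul]
    nlinarith
  have hexp : Real.exp (1 / 2) ≤ 2 := by
    have h1 := Real.exp_one_lt_d9
    have h2 : Real.exp (1 / 2) ^ 2 = Real.exp 1 := by rw [← Real.exp_nat_mul]; norm_num
    nlinarith [Real.exp_pos (1 / 2)]
  have hm : ∀ s : ℝ, s ^ 2 = (c : ℝ)⁻¹ → ∫ ω, Real.exp (s * X ω) ∂μ ≤ 2 := by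
    intro s hs
    refine (h.mgf_le s).trans (le_trans (le_of_eq ?_) hexp)
    rw [hs, mul_inv_cancel₀ hc'.ne']
  have hi := integral_mono (hint.const_mul (l ^ 2))
    (((h.integrable_exp_mul l).add (h.integrable_exp_mul (-l))).sub (integrable_const 2)) hpt
  rw [integral_const_mul, integral_sub' ((h.integrable_exp_mul l).add (h.integrable_exp_mul (-l)))
    (integrable_const 2), integral_add' (h.integrable_exp_mul l) (h.integrable_exp_mul (-l))] at hi
  simp only [integral_const, probReal_univ, smul_eq_mul, one_mul] at hi
  have h1 := hm l hl2
  have h2 := hm (-l) (by rw [neg_sq, hl2])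
  rw [hl2] at hi
  have h3 : (c : ℝ)⁻¹ * ∫ ω, X ω ^ 2 ∂μ ≤ 2 := by linarith
  rwa [inv_mul_le_iff₀ hc', mul_comm] at h3

lemma hasSubgaussianMGF_linear_combination {ι : Type*} [Fintype ι] {X : ι → Ω → ℝ}
    (hind : iIndepFun X μ) (hX : ∀ i, HasSubgaussianMGF (X i) 1 μ) (c : ι → ℝ) {V : NNReal}
    (hV : ∑ i, c i ^ 2 ≤ V) : HasSubgaussianMGF (fun ω => ∑ i, c i * X i ω) V μ := by
  have h1 : iIndepFun (fun i ω => c i * X i ω) μ :=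
    hind.comp (fun i x => c i * x) (fun i => measurable_const_mul _)
  have h2 := HasSubgaussianMGF.sum_of_iIndepFun h1 (s := Finset.univ)
    (c := fun i => NNReal.mk (c i ^ 2) (sq_nonneg _) * 1) (fun i _ => (hX i).const_mul (c i))
  refine hasSubgaussianMGF_mono h2 ?_
  rw [← NNReal.coe_le_coe]
  refine le_trans (le_of_eq ?_) hV
  rw [NNReal.coe_sum]
  exact Finset.sum_congr rfl fun i _ => by rw [mul_one]; rfl

/-- The rounds `t < M` in which cyclic exploration of `k` vectors takes the `j`-th vector. -/
def roundClass (k M : ℕ) (j : Fin k) : Finset (Fin M) := {t | (t : ℕ) % k = j}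

/-- The mean of `z` over the rounds `t < M` in which the `j`-th vector is explored. -/
def classMean (k M : ℕ) (z : ℕ → ℝ) (j : Fin k) : ℝ :=
  (∑ t ∈ roundClass k M j, z t) / (roundClass k M j).card

lemma sum_roundClass {α : Type*} [AddCommMonoid α] {k M : ℕ} (hk : 0 < k)
    (f : Fin k → Fin M → α) :
    ∑ j, ∑ t ∈ roundClass k M j, f j t =
      ∑ t : Fin M, f ⟨(t : ℕ) % k, Nat.mod_lt _ hk⟩ t := by
  simp only [roundClass, Finset.sum_filter]
  rw [Finset.sum_comm]
  refine Finset.sum_congr rfl fun t _ => ?_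
  rw [Finset.sum_eq_single ⟨(t : ℕ) % k, Nat.mod_lt _ hk⟩]
  · simp
  · intro j _ hj
    rw [if_neg]
    intro h
    exact hj (Fin.ext h.symm)
  · simp

/-- There are at least `k⌊√N⌋` rounds, so each vector is explored at least `⌊√N⌋ ≥ √N / 2` times.
The lemma also serves RE, since `reLength` and `rtLength` have the same body. -/
lemma sqrt_le_two_mul_card_roundClass {k N : ℕ} (hN : 1 ≤ N) (j : Fin k) :
    √(N : ℝ) ≤ 2 * (roundClass k (rtLength k N) j).card := by
  have hq1 : 1 ≤ Nat.sqrt N := Nat.le_sqrt.mpr (by omega)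
  have hq : Nat.sqrt N ≤ (roundClass k (rtLength k N) j).card := by
    have hlen : k * Nat.sqrt N ≤ rtLength k N := by
      have : ((k * Nat.sqrt N : ℕ) : ℝ) ≤ (rtLength k N : ℝ) := by
        refine le_trans ?_ (Nat.le_ceil _)
        push_cast
        gcongr
        exact Real.nat_sqrt_le_real_sqrt
      exact_mod_cast this
    have hlt : ∀ i < Nat.sqrt N, (j : ℕ) + k * i < rtLength k N := by
      intro i hi
      have := j.2
      have : k * (i + 1) ≤ k * Nat.sqrt N := Nat.mul_le_mul_left _ hi
      rw [Nat.mul_add] at this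
      omega
    have := Finset.card_le_card_of_injOn (s := (Finset.univ : Finset (Fin (Nat.sqrt N))))
      (t := roundClass k (rtLength k N) j) (fun i => ⟨(j : ℕ) + k * i, hlt i i.2⟩)
      (by
        intro i _
        simp [roundClass, Nat.mod_eq_of_lt j.2])
      (by
        intro a _ b _ hab
        have hk : 0 < k := lt_of_le_of_lt (Nat.zero_le _) j.2
        simp only [Fin.mk.injEq, Nat.add_left_cancel_iff] at hab
        exact Fin.ext (Nat.eq_of_mul_eq_mul_left hk hab))
    simpa using this
  have hs : √(N : ℝ) ≤ Nat.sqrt N + 1 := Real.real_sqrt_le_nat_sqrt_succ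
  have hq' : (Nat.sqrt N : ℝ) ≤ (roundClass k (rtLength k N) j).card := by exact_mod_cast hq
  have hq1' : (1 : ℝ) ≤ Nat.sqrt N := by exact_mod_cast hq1
  linarith

/-- A class mean averages at least `√N / 2` noise variables, whence the factor `2/√N`. Expanding
everything into one linear combination of the raw noise requires only the independence of the
latter. -/
lemma hasSubgaussianMGF_sum_classMean {ι : Type*} [Fintype ι] {k N : ℕ} (hk : 0 < k)
    (hN : 1 ≤ N) {X : ι → ℕ → Ω → ℝ}
    (hind : iIndepFun (fun (p : ι × Fin (rtLength k N)) => X p.1 p.2) μ)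
    (hX : ∀ i, ∀ t < rtLength k N, HasSubgaussianMGF (X i t) 1 μ) (b : ι → Fin k → ℝ)
    {V : NNReal} (hV : (∑ i, ∑ j, b i j ^ 2) * (2 / √(N : ℝ)) ≤ V) :
    HasSubgaussianMGF
      (fun ω => ∑ i, ∑ j, b i j * classMean k (rtLength k N) (fun t => X i t ω) j) V μ := by
  set M := rtLength k N
  have hs : 0 < √(N : ℝ) := Real.sqrt_pos.mpr (by exact_mod_cast hN)
  let g : Fin M → Fin k := fun t => ⟨(t : ℕ) % k, Nat.mod_lt _ hk⟩
  let m : Fin k → ℝ := fun j => (roundClass k M j).card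
  have hm : ∀ j, √(N : ℝ) ≤ 2 * m j := sqrt_le_two_mul_card_roundClass hN
  have hmpos : ∀ j, 0 < m j := fun j => by linarith [hm j]
  have h := hasSubgaussianMGF_linear_combination hind (fun p => hX p.1 p.2 p.2.2)
    (fun p => b p.1 (g p.2) / m (g p.2)) (V := V) ?_
  · refine h.congr (ae_of_all _ fun ω => ?_)
    simp only [Fintype.sum_prod_type]
    refine Finset.sum_congr rfl fun i _ => ?_
    rw [← sum_roundClass hk (fun j t => b i j / m j * X i t ω)]
    refine Finset.sum_congr rfl fun j _ => ?_
    rw [← Finset.mul_sum, classMean]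
    ring
  · refine le_trans ?_ hV
    rw [Fintype.sum_prod_type, Finset.sum_mul]
    refine Finset.sum_le_sum fun i _ => ?_
    rw [← sum_roundClass hk (fun j t => (b i j / m j) ^ 2), Finset.sum_mul]
    refine Finset.sum_le_sum fun j _ => ?_
    rw [Finset.sum_const, nsmul_eq_mul, div_pow]
    change m j * (b i j ^ 2 / m j ^ 2) ≤ _
    have h1 : m j * (b i j ^ 2 / m j ^ 2) = b i j ^ 2 * (1 / m j) := by
      have := (hmpos j).ne'
      field_simp
    rw [h1]
    refine mul_le_mul_of_nonneg_left ?_ (sq_nonneg _)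
    rw [div_le_div_iff₀ (hmpos j) hs]
    linarith [hm j]

lemma measurable_classMean {k M : ℕ} {X : ℕ → Ω → ℝ} (hX : ∀ t < M, Measurable (X t))
    (j : Fin k) : Measurable fun ω => classMean k M (fun t => X t ω) j :=
  Measurable.div_const (Finset.measurable_fun_sum _ fun (t : Fin M) _ => hX t t.2) _

lemma integral_sum_classMean_sq_le [IsProbabilityMeasure μ] {k N : ℕ} (hk : 0 < k) (hN : 1 ≤ N)
    {X : ℕ → Ω → ℝ} (hind : iIndepFun (fun t : Fin (rtLength k N) => X (t : ℕ)) μ)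
    (hX : ∀ t < rtLength k N, HasSubgaussianMGF (X t) 1 μ) :
    Integrable (fun ω => ∑ j, classMean k (rtLength k N) (fun t => X t ω) j ^ 2) μ ∧
    ∫ ω, ∑ j, classMean k (rtLength k N) (fun t => X t ω) j ^ 2 ∂μ ≤ k * (4 / √(N : ℝ)) := by
  have hs : 0 < √(N : ℝ) := Real.sqrt_pos.mpr (by exact_mod_cast hN)
  let V : NNReal := NNReal.mk (2 / √(N : ℝ)) (by positivity)
  have hV : (0 : NNReal) < V := by
    rw [← NNReal.coe_pos]; change 0 < 2 / √(N : ℝ); positivity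
  have key : ∀ j : Fin k, HasSubgaussianMGF
      (fun ω => classMean k (rtLength k N) (fun t => X t ω) j) V μ := by
    intro j
    have h := hasSubgaussianMGF_sum_classMean (μ := μ) (ι := Unit) hk hN
      (X := fun _ => X) (V := V)
      (hind.precomp (g := fun p : Unit × Fin (rtLength k N) => p.2)
        (fun p q hpq => Prod.ext rfl hpq)) (fun _ => hX)
      (fun _ i => if i = j then 1 else 0) (by simp [V])
    simpa using h
  have hsq := fun j => integral_sq_le_of_hasSubgaussianMGF (key j) hV
  refine ⟨integrable_finsetSum _ fun j _ => (hsq j).1, ?_⟩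
  rw [integral_finsetSum _ fun j _ => (hsq j).1]
  refine (Finset.sum_le_sum fun j _ => (hsq j).2).trans (le_of_eq ?_)
  rw [Finset.sum_const, Finset.card_univ, Fintype.card_fin, nsmul_eq_mul]
  change (k : ℝ) * (2 * (2 / √(N : ℝ))) = _
  ring

/-- With high probability, the Gram form of the estimation errors of all tasks in `ι` is bounded
in operator norm. -/
lemma exists_event_gram_le [IsProbabilityMeasure μ] {ι : Type*} [Fintype ι] {d N : ℕ}
    (hd : 0 < d) (hN : 1 ≤ N) {X : ι → ℕ → Ω → ℝ}
    (hm : ∀ i, ∀ t < rtLength d N, Measurable (X i t))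
    (hind : iIndepFun (fun (p : ι × Fin (rtLength d N)) => X p.1 p.2) μ)
    (hX : ∀ i, ∀ t < rtLength d N, HasSubgaussianMGF (X i t) 1 μ)
    (a : ι → OrthonormalBasis (Fin d) ℝ (Vec d)) {t : ℝ} (ht : 0 ≤ t) :
    ∃ G : Set Ω, MeasurableSet G ∧
      μ.real Gᶜ ≤ 5 ^ (Fintype.card ι + d) * Real.exp (-t ^ 2 / (2 * (2 / √(N : ℝ)))) ∧
      ∀ ω ∈ G, ∀ v : Vec d,
        ∑ i, inner ℝ (∑ j, classMean d (rtLength d N) (fun u => X i u ω) j • a i j) v ^ 2 ≤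
          16 * t ^ 2 * ‖v‖ ^ 2 := by
  obtain ⟨sE, hcE, hE1, hE⟩ := exists_finset_half_net (Vec d)
  obtain ⟨sF, hcF, hF1, hF⟩ := exists_finset_half_net (EuclideanSpace ℝ ι)
  -- The bilinear form `∑ y_i ⟨e_i, x⟩` of the error vectors `e_i`. Its coefficients have square sum
  -- `‖x‖²‖y‖² ≤ 1`, so each value has variance proxy `2/√N`; a union bound runs over the pairs of
  -- net points.
  let Z : Vec d → EuclideanSpace ℝ ι → Ω → ℝ := fun x y ω =>
    ∑ i, ∑ j, (y i * inner ℝ (a i j) x) * classMean d (rtLength d N) (fun u => X i u ω) j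
  let V : NNReal := NNReal.mk (2 / √(N : ℝ)) (by positivity)
  have hZ : ∀ x ∈ sE, ∀ y ∈ sF, HasSubgaussianMGF (Z x y) V μ := by
    intro x hx y hy
    refine hasSubgaussianMGF_sum_classMean hd hN hind hX _ ?_
    change _ ≤ 2 / √(N : ℝ)
    have h1 : ∑ i, ∑ j, (y i * inner ℝ (a i j) x) ^ 2 ≤ 1 := by
      have hx1 : ‖x‖ ^ 2 ≤ 1 := by nlinarith [hE1 x hx, norm_nonneg x]
      have hy1 : ‖y‖ ^ 2 ≤ 1 := by nlinarith [hF1 y hy, norm_nonneg y]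
      simp_rw [mul_pow, ← Finset.mul_sum, OrthonormalBasis.sum_sq_inner_right]
      rw [← Finset.sum_mul]
      rw [EuclideanSpace.norm_sq_eq] at hy1
      simp only [Real.norm_eq_abs, sq_abs] at hy1
      nlinarith [sq_nonneg ‖x‖, Finset.sum_nonneg fun i (_ : i ∈ Finset.univ) => sq_nonneg (y i)]
    have h2 : 0 ≤ 2 / √(N : ℝ) := by positivity
    nlinarith
  have hZm : ∀ x y, Measurable (Z x y) := fun x y =>
    Finset.measurable_fun_sum _ fun i _ => Finset.measurable_fun_sum _ fun j _ =>
      (measurable_classMean (hm i) j).const_mul _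
  let Bad : Set Ω := ⋃ p ∈ sE ×ˢ sF, {ω | t ≤ Z p.1 p.2 ω}
  have hBad : MeasurableSet Bad :=
    Finset.measurableSet_biUnion _ fun p _ => measurableSet_le measurable_const (hZm _ _)
  refine ⟨Badᶜ, hBad.compl, ?_, ?_⟩
  · rw [compl_compl]
    calc μ.real Bad ≤ ∑ p ∈ sE ×ˢ sF, μ.real {ω | t ≤ Z p.1 p.2 ω} :=
          measureReal_biUnion_finset_le _ _
      _ ≤ ∑ p ∈ sE ×ˢ sF, Real.exp (-t ^ 2 / (2 * (2 / √(N : ℝ)))) := by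
          refine Finset.sum_le_sum fun p hp => ?_
          have hp := Finset.mem_product.mp hp
          exact (hZ _ hp.1 _ hp.2).measure_ge_le ht
      _ = ((sE.card * sF.card : ℕ) : ℝ) * Real.exp (-t ^ 2 / (2 * (2 / √(N : ℝ)))) := by
          rw [Finset.sum_const, Finset.card_product, nsmul_eq_mul]
      _ ≤ _ := by
          gcongr
          rw [add_comm, pow_add]
          have := Nat.mul_le_mul hcE hcF
          simp only [finrank_euclideanSpace, Fintype.card_fin] at this
          exact_mod_cast this
  · intro ω hω v
    let e : ι → Vec d := fun i => ∑ j, classMean d (rtLength d N) (fun u => X i u ω) j • a i j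
    -- `T v = (⟨e_i, v⟩)_i`, so the Gram form is `‖T v‖²` and `16 t²` is the square of `4t`.
    let T : Vec d →L[ℝ] EuclideanSpace ℝ ι :=
      (PiLp.continuousLinearEquiv 2 ℝ (fun _ : ι => ℝ)).symm.toContinuousLinearMap ∘L
        ContinuousLinearMap.pi fun i => innerSL ℝ (e i)
    have hT : ∀ x i, T x i = inner ℝ (e i) x := fun x i => rfl
    have hTn : ‖T‖ ≤ 4 * t := by
      refine opNorm_le_four_mul_of_net T hE hF ht fun x hx y hy => ?_
      have hle : Z x y ω < t := by
        by_contra hc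
        apply hω
        exact Set.mem_biUnion (Finset.mem_product.mpr ⟨hx, hy⟩ : (x, y) ∈ sE ×ˢ sF)
          (not_lt.mp hc)
      refine le_trans (le_of_eq ?_) hle.le
      rw [PiLp.inner_apply]
      refine Finset.sum_congr rfl fun i _ => ?_
      rw [hT]
      simp only [e, sum_inner, inner_smul_left, RCLike.inner_apply, conj_trivial]
      rw [Finset.sum_mul]
      refine Finset.sum_congr rfl fun j _ => ?_
      ring
    have h1 : ‖T v‖ ^ 2 ≤ (4 * t * ‖v‖) ^ 2 := by
      have := (T.le_opNorm v).trans (mul_le_mul_of_nonneg_right hTn (norm_nonneg v))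
      gcongr
    rw [EuclideanSpace.norm_sq_eq] at h1
    simp only [Real.norm_eq_abs, sq_abs, hT] at h1
    refine h1.trans (le_of_eq (by ring))

lemma integral_le_add_mul_measure_compl [IsProbabilityMeasure μ] {f : Ω → ℝ}
    {G : Set Ω} (hG : MeasurableSet G) {A B : ℝ} (hA : 0 ≤ A) (hfi : Integrable f μ)
    (hfG : ∀ ω ∈ G, f ω ≤ A) (hfB : ∀ ω, f ω ≤ B) : ∫ ω, f ω ∂μ ≤ A + B * μ.real Gᶜ := by
  have hi : Integrable (fun ω => A + Gᶜ.indicator (fun _ => B) ω) μ :=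
    (integrable_const A).add ((integrable_const B).indicator hG.compl)
  calc ∫ ω, f ω ∂μ ≤ ∫ ω, (A + Gᶜ.indicator (fun _ => B) ω) ∂μ := by
        refine integral_mono hfi hi fun ω => ?_
        by_cases h : ω ∈ G
        · simpa [h] using hfG ω h
        · simp only [Set.mem_compl_iff, h, not_false_eq_true, Set.indicator_of_mem]
          linarith [hfB ω]
    _ = A + B * μ.real Gᶜ := by
        rw [integral_add (integrable_const A) ((integrable_const B).indicator hG.compl),
          integral_indicator_const _ hG.compl]
        simp [mul_comm]

end Probability

/-! ### Exploration lengths. -/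

section Lengths

variable {k N : ℕ}

lemma rtLength_le_two_mul (hk : 1 ≤ k) (hN : 1 ≤ N) :
    (rtLength k N : ℝ) ≤ 2 * (k * √(N : ℝ)) := by
  have h1 : (1 : ℝ) ≤ √(N : ℝ) := Real.one_le_sqrt.mpr (by exact_mod_cast hN)
  have h2 : (1 : ℝ) ≤ k := by exact_mod_cast hk
  have h3 := (Nat.ceil_lt_add_one (show 0 ≤ (k : ℝ) * √(N : ℝ) by positivity)).le
  change (rtLength k N : ℝ) ≤ _ at h3
  nlinarith

lemma rtLength_le (h : k ^ 2 ≤ N) : rtLength k N ≤ N := by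
  refine Nat.ceil_le.mpr ?_
  have h1 : (k : ℝ) ≤ √(N : ℝ) := by
    rw [← Real.sqrt_sq (Nat.cast_nonneg k)]
    exact Real.sqrt_le_sqrt (by exact_mod_cast h)
  calc (k : ℝ) * √(N : ℝ) ≤ √(N : ℝ) * √(N : ℝ) := by gcongr
    _ = N := Real.mul_self_sqrt (Nat.cast_nonneg N)

end Lengths

/-! ### Matrices as operators; the top singular vectors of a Gram matrix. -/

section Matrices

variable {d r : ℕ}

lemma toLp_mulVec_eq_sum (A : Matrix (Fin d) (Fin r) ℝ) (z : Fin r → ℝ) :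
    (WithLp.toLp 2 (A *ᵥ z) : Vec d) = ∑ j, z j • colVec A j := by
  ext i
  simp [Matrix.mulVec, dotProduct, colVec, mul_comm]

lemma transpose_mulVec_eq_inner (A : Matrix (Fin d) (Fin r) ℝ) (v : Vec d) :
    Aᵀ *ᵥ v.ofLp = fun j => inner ℝ (colVec A j) v := by
  ext j
  simp [Matrix.mulVec, dotProduct, colVec, PiLp.inner_apply, mul_comm]

lemma mem_span_colVec_iff (A : Matrix (Fin d) (Fin r) ℝ) (v : Vec d) :
    v ∈ Submodule.span ℝ (Set.range (colVec A)) ↔ ∃ z : Fin r → ℝ, v = WithLp.toLp 2 (A *ᵥ z) := by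
  rw [Submodule.mem_span_range_iff_exists_fun]
  simp_rw [toLp_mulVec_eq_sum, eq_comm]

lemma colVec_mul_diagonal (A : Matrix (Fin d) (Fin r) ℝ) (f : Fin r → ℝ) (i : Fin r) :
    colVec (A * Matrix.diagonal f) i = f i • colVec A i := by
  ext j
  simp [colVec, mul_comm]

lemma toEuclideanLin_colVec (P : Matrix (Fin d) (Fin d) ℝ) (A : Matrix (Fin d) (Fin r) ℝ)
    (i : Fin r) : Matrix.toEuclideanLin P (colVec A i) = colVec (P * A) i := by
  ext j
  simp [colVec, Matrix.toLpLin_apply, Matrix.mul_apply, Matrix.mulVec, dotProduct]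

lemma orthonormal_colVec {A : Matrix (Fin d) (Fin r) ℝ} (h : Aᵀ * A = 1) :
    Orthonormal ℝ (colVec A) := by
  rw [orthonormal_iff_ite]
  intro i j
  have := congrFun (congrFun h i) j
  rw [Matrix.one_apply] at this
  rw [← this]
  simp [colVec, PiLp.inner_apply, Matrix.mul_apply, mul_comm]

lemma toEuclideanLin_sum_vecMulVec {ι : Type*} [Fintype ι] (y : ι → Vec d) (v : Vec d) :
    Matrix.toEuclideanLin (∑ i, Matrix.vecMulVec (y i) (y i)) v =
      ∑ i, inner ℝ (y i) v • y i := by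
  rw [map_sum, LinearMap.sum_apply]
  refine Finset.sum_congr rfl fun i _ => ?_
  ext j
  simp only [Matrix.toLpLin_apply, Matrix.mulVec, Matrix.vecMulVec_apply, dotProduct,
    PiLp.smul_apply, smul_eq_mul, PiLp.inner_apply, RCLike.inner_apply, conj_trivial,
    Finset.sum_mul]
  refine Finset.sum_congr rfl fun l _ => ?_
  ring

lemma isSymmetric_sum_vecMulVec {ι : Type*} [Fintype ι] (y : ι → Vec d) :
    (Matrix.toEuclideanLin (∑ i, Matrix.vecMulVec (y i) (y i))).IsSymmetric := by
  intro v w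
  rw [toEuclideanLin_sum_vecMulVec, toEuclideanLin_sum_vecMulVec, sum_inner, inner_sum]
  refine Finset.sum_congr rfl fun i _ => ?_
  rw [inner_smul_left, inner_smul_right, real_inner_comm (y i) v]
  simp; ring

lemma inner_sum_vecMulVec {ι : Type*} [Fintype ι] (y : ι → Vec d) (v : Vec d) :
    inner ℝ v (Matrix.toEuclideanLin (∑ i, Matrix.vecMulVec (y i) (y i)) v) =
      ∑ i, inner ℝ (y i) v ^ 2 := by
  rw [toEuclideanLin_sum_vecMulVec, inner_sum]
  refine Finset.sum_congr rfl fun i _ => ?_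
  rw [inner_smul_right, real_inner_comm]; ring

lemma IsTopSingularVectors.transpose_mul_self {P : Matrix (Fin d) (Fin d) ℝ}
    {A : Matrix (Fin d) (Fin r) ℝ} (h : IsTopSingularVectors P A) : Aᵀ * A = 1 := by
  obtain ⟨hrd, U, V, σ, hU, -, -, -, -, hA⟩ := h
  ext i j
  have := congrFun (congrFun hU (Fin.castLE hrd i)) (Fin.castLE hrd j)
  simp only [Matrix.mul_apply, Matrix.transpose_apply, Matrix.one_apply, hA] at this ⊢
  rw [this]
  simp

/-- The two factors `U`, `V` of the decomposition may differ, but `P² U = U Σ²` holds for symmetric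
`P`, and positivity makes the columns of `U` eigenvectors of `P`. Then Courant–Fischer applies. -/
lemma IsTopSingularVectors.gram_le {ι : Type*} [Fintype ι] {y : ι → Vec d}
    {A : Matrix (Fin d) (Fin r) ℝ}
    (h : IsTopSingularVectors (∑ i, Matrix.vecMulVec (y i) (y i)) A) (S : Submodule ℝ (Vec d))
    (hS : Module.finrank ℝ S ≤ r) {K : ℝ}
    (hK : ∀ w ∈ Sᗮ, ∑ i, inner ℝ (y i) w ^ 2 ≤ K * ‖w‖ ^ 2) {v : Vec d}
    (hv : ∀ j, inner ℝ (colVec A j) v = 0) :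
    ∑ i, inner ℝ (y i) v ^ 2 ≤ K * ‖v‖ ^ 2 := by
  obtain ⟨hrd, U, V, σ, hU, hV, hσ, hσ0, hP, hA⟩ := h
  set P := ∑ i, Matrix.vecMulVec (y i : Fin d → ℝ) (y i) with hPdef
  have hPt : Pᵀ = P := by
    rw [hPdef, Matrix.transpose_sum]
    exact Finset.sum_congr rfl fun i _ => Matrix.transpose_vecMulVec _ _
  have hPPU : P * (P * U) = U * Matrix.diagonal fun i => σ i ^ 2 := by
    have h1 : P = V * Matrix.diagonal σ * Uᵀ := by
      rw [← hPt]
      conv_lhs => rw [hP]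
      simp [Matrix.transpose_mul, Matrix.mul_assoc]
    have h2 : P * U = V * Matrix.diagonal σ := by
      conv_lhs => rw [h1]
      rw [Matrix.mul_assoc, hU, Matrix.mul_one]
    rw [h2]
    conv_lhs => rw [hP]
    rw [Matrix.mul_assoc, ← Matrix.mul_assoc Vᵀ, hV, Matrix.one_mul, Matrix.mul_assoc,
      Matrix.diagonal_mul_diagonal]
    simp_rw [sq]
  have hon := orthonormal_colVec hU
  let u : OrthonormalBasis (Fin d) ℝ (Vec d) :=
    OrthonormalBasis.mk hon (by
      rw [hon.linearIndependent.span_eq_top_of_card_eq_finrank' (by simp)])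
  have hu : ∀ i, u i = colVec U i := fun i => by simp [u]
  have heig : ∀ i, Matrix.toEuclideanLin P (u i) = σ i • u i := by
    intro i
    refine apply_eq_smul_of_apply_apply_eq (isSymmetric_sum_vecMulVec y)
      (fun x => ?_) (hσ0 i) ?_
    · rw [inner_sum_vecMulVec]; positivity
    · rw [hu, toEuclideanLin_colVec, toEuclideanLin_colVec, hPPU, colVec_mul_diagonal]
  have hform : ∀ w, ∑ i, inner ℝ (y i) w ^ 2 = ∑ i, σ i * inner ℝ (u i) w ^ 2 := fun w => by
    rw [← inner_sum_vecMulVec, ← inner_apply_eq_sum_of_eigenbasis u heig]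
  rw [hform]
  refine form_le_of_orthogonal_top hrd u hσ S hS (fun w hw => ?_) fun j => ?_
  · rw [← hform]; exact hK w hw
  · rw [← hv j, hu]
    congr 1
    ext i
    simp [colVec, hA]

lemma finrank_span_colVec_le (B : Matrix (Fin d) (Fin r) ℝ) :
    Module.finrank ℝ (Submodule.span ℝ (Set.range (colVec B))) ≤ r := by
  simpa [Set.finrank] using finrank_range_le_card (R := ℝ) (colVec B)

lemma mul_norm_sq_le_window {θ : ℕ → Vec d} {s L : ℕ} (S : Submodule ℝ (Vec d))
    (hS : Module.finrank ℝ S ≤ r) (hr : 1 ≤ r) (hθ : ∀ j < L, θ (s + j) ∈ S) {ν : ℝ}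
    (hν : 0 < ν) (h : ν ≤ singularValue r (windowMatrix θ s L * (windowMatrix θ s L)ᵀ))
    {z : Vec d} (hz : z ∈ S) :
    ν * ‖z‖ ^ 2 ≤ ∑ j : Fin L, inner ℝ (θ (s + j)) z ^ 2 := by
  have hW : windowMatrix θ s L * (windowMatrix θ s L)ᵀ =
      ∑ j : Fin L, Matrix.vecMulVec (θ (s + j) : Fin d → ℝ) (θ (s + j)) := by
    ext a b
    simp [Matrix.mul_apply, windowMatrix, Matrix.sum_apply, Matrix.vecMulVec_apply]
  rw [hW] at h
  rw [← inner_sum_vecMulVec fun j : Fin L => θ (s + j)]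
  refine mul_norm_sq_le_inner_of_singularValues
    (isSymmetric_sum_vecMulVec fun j : Fin L => θ (s + j)) (fun x => ?_) S (fun x => ?_) hr hS hν
    h hz
  · rw [inner_sum_vecMulVec fun j : Fin L => θ (s + j)]; positivity
  · rw [toEuclideanLin_sum_vecMulVec fun j : Fin L => θ (s + j)]
    exact S.sum_mem fun j _ => S.smul_mem _ (hθ j j.2)

end Matrices

/-! ### Closed forms and errors of the least-squares estimates. -/

section Estimates

variable {d k : ℕ}

lemma cyclicAction_eq (hk : 0 < k) (a : Fin k → Vec d) (t : ℕ) :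
    cyclicAction a t = a ⟨t % k, Nat.mod_lt t hk⟩ := dif_pos hk

lemma norm_cyclicAction_le {a : Fin k → Vec d} (ha : ∀ j, ‖a j‖ = 1) (t : ℕ) :
    ‖cyclicAction a t‖ ≤ 1 := by
  unfold cyclicAction
  split_ifs
  · exact (ha _).le
  · simp

/-- RE is RT with the identity as representation, so one computation covers both. -/
lemma reEstimate_eq_rtEstimate (a : Fin d → Vec d) (θ : Vec d) (η : ℕ → ℝ) (N : ℕ) :
    reEstimate a θ η N = rtEstimate 1 a θ η N := by
  have h : rtEstimate 1 a θ η N =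
      let X := actionMatrix (cyclicAction a) (rtLength d N)
      WithLp.toLp 2 ((X * Xᵀ)⁻¹ *ᵥ
        (X *ᵥ rewardVector (cyclicAction a) θ η (rtLength d N))) := by
    simp [rtEstimate]
  exact h.symm

/-- The least-squares estimate of RT, in coordinates with respect to the explored basis. -/
lemma rtEstimate_eq_sum {N : ℕ} (hk : 0 < k) (hN : 1 ≤ N) {A : Matrix (Fin d) (Fin k) ℝ}
    (hA : Aᵀ * A = 1) {a : Fin k → Vec d} (ha : Orthonormal ℝ a)
    (hspan : Submodule.span ℝ (Set.range a) = Submodule.span ℝ (Set.range (colVec A)))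
    (θ : Vec d) (η : ℕ → ℝ) :
    rtEstimate A a θ η N =
      ∑ j, (inner ℝ (a j) θ + classMean k (rtLength k N) η j) • a j := by
  set M := rtLength k N
  set X := actionMatrix (cyclicAction a) M with hX
  set Y := rewardVector (cyclicAction a) θ η M with hY
  have hs : 0 < √(N : ℝ) := Real.sqrt_pos.mpr (by exact_mod_cast hN)
  have hm : ∀ j, (0 : ℝ) < (roundClass k M j).card := fun j => by
    have := sqrt_le_two_mul_card_roundClass hN j
    change _ ≤ 2 * ((roundClass k M j).card : ℝ) at this
    linarith
  have hcol : ∀ t, colVec X t = a ⟨(t : ℕ) % k, Nat.mod_lt _ hk⟩ := fun t => by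
    rw [← cyclicAction_eq hk a]
    rfl
  set w : Vec d := ∑ j, (inner ℝ (a j) θ + classMean k M η j) • a j with hw
  have haw : ∀ j, inner ℝ (a j) w = inner ℝ (a j) θ + classMean k M η j := fun j => by
    rw [hw, ha.inner_right_fintype]
  -- The claimed value solves the normal equations: grouped by explored vector, both sides have the
  -- same coefficient on each `a j`.
  have hnormal : X *ᵥ (Xᵀ *ᵥ w.ofLp) = X *ᵥ Y := by
    apply WithLp.toLp_injective 2
    change (WithLp.toLp 2 (X *ᵥ (Xᵀ *ᵥ w.ofLp)) : Vec d) = WithLp.toLp 2 (X *ᵥ Y)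
    rw [transpose_mulVec_eq_inner, toLp_mulVec_eq_sum, toLp_mulVec_eq_sum]
    simp only [hcol]
    have hYt : ∀ t, Y t = inner ℝ (a ⟨(t : ℕ) % k, Nat.mod_lt _ hk⟩) θ + η t := fun t => by
      rw [hY, rewardVector, cyclicAction_eq hk]
    simp only [hYt]
    rw [← sum_roundClass hk (fun j _ => inner ℝ (a j) w • a j),
      ← sum_roundClass hk (fun j t => (inner ℝ (a j) θ + η t) • a j)]
    refine Finset.sum_congr rfl fun j _ => ?_
    rw [← Finset.sum_smul, ← Finset.sum_smul]
    congr 1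
    rw [Finset.sum_add_distrib, Finset.sum_const, Finset.sum_const, haw, classMean,
      nsmul_eq_mul, nsmul_eq_mul, mul_add, mul_div_cancel₀ _ (hm j).ne']
  obtain ⟨z, hz⟩ := (mem_span_colVec_iff A w).mp (by
    rw [← hspan]
    exact Submodule.sum_mem _ fun j _ => Submodule.smul_mem _ _ (Submodule.subset_span ⟨j, rfl⟩))
  -- If `y` is in the kernel, then `A y` is orthogonal to every explored vector, each being taken at
  -- least once, and lies in their span; so it vanishes.
  have hinj : Function.Injective (Aᵀ * X * Xᵀ * A).mulVec := by
    rw [← Matrix.coe_mulVecLin, injective_iff_map_eq_zero]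
    intro y hy
    rw [Matrix.mulVecLin_apply] at hy
    set v : Vec d := WithLp.toLp 2 (A *ᵥ y) with hv
    have h1 : ∑ t, inner ℝ (colVec X t) v ^ 2 = 0 := by
      have h2 : y ⬝ᵥ ((Aᵀ * X * Xᵀ * A) *ᵥ y) = (Xᵀ *ᵥ v.ofLp) ⬝ᵥ (Xᵀ *ᵥ v.ofLp) := by
        rw [hv, ← Matrix.mulVec_mulVec, ← Matrix.mulVec_mulVec, ← Matrix.mulVec_mulVec,
          Matrix.dotProduct_mulVec, Matrix.vecMul_transpose, Matrix.dotProduct_mulVec,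
          ← Matrix.mulVec_transpose]
      rw [hy, dotProduct_zero, transpose_mulVec_eq_inner] at h2
      rw [h2, dotProduct]
      exact Finset.sum_congr rfl fun t _ => sq _
    simp only [hcol] at h1
    rw [← sum_roundClass hk (fun j _ => inner ℝ (a j) v ^ 2)] at h1
    simp only [Finset.sum_const, nsmul_eq_mul] at h1
    rw [Finset.sum_eq_zero_iff_of_nonneg fun j _ => by positivity] at h1
    have hav : ∀ j, inner ℝ (a j) v = 0 := fun j => by
      have := h1 j (Finset.mem_univ j)
      simpa [(hm j).ne'] using this
    have hv0 : v = 0 := by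
      have hvs : v ∈ Submodule.span ℝ (Set.range a) := by
        rw [hspan, mem_span_colVec_iff]; exact ⟨y, rfl⟩
      have hvo : v ∈ (Submodule.span ℝ (Set.range a))ᗮ := by
        rw [Submodule.mem_orthogonal]
        intro x hx
        induction hx using Submodule.span_induction with
        | mem x hx => obtain ⟨j, rfl⟩ := hx; exact hav j
        | zero => simp
        | add x y _ _ hx hy => rw [inner_add_left, hx, hy, add_zero]
        | smul c x _ hx => rw [inner_smul_left, hx, mul_zero]
      exact (Submodule.mem_bot ℝ).mp ((Submodule.inf_orthogonal_eq_bot (Submodule.span ℝ (Set.range a))) ▸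
        Submodule.mem_inf.mpr ⟨hvs, hvo⟩)
    have hAy : A *ᵥ y = 0 := congrArg WithLp.ofLp hv0
    rw [← Matrix.one_mulVec y, ← hA, ← Matrix.mulVec_mulVec, hAy, Matrix.mulVec_zero]
  have hunit := Matrix.mulVec_injective_iff_isUnit.mp hinj
  have hsol : (Aᵀ * X) *ᵥ Y = (Aᵀ * X * Xᵀ * A) *ᵥ z := by
    have : w.ofLp = A *ᵥ z := congrArg WithLp.ofLp hz
    rw [← Matrix.mulVec_mulVec, ← hnormal, this]
    simp only [Matrix.mulVec_mulVec, Matrix.mul_assoc]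
  change WithLp.toLp 2 (A *ᵥ ((Aᵀ * X * Xᵀ * A)⁻¹ *ᵥ ((Aᵀ * X) *ᵥ Y))) = w
  rw [hsol, Matrix.mulVec_mulVec z,
    Matrix.nonsing_inv_mul _ ((Matrix.isUnit_iff_isUnit_det _).mp hunit), Matrix.one_mulVec, hz]

lemma reEstimate_eq_add_sum {N : ℕ} (hd : 0 < d) (hN : 1 ≤ N)
    (a : OrthonormalBasis (Fin d) ℝ (Vec d)) (θ : Vec d) (η : ℕ → ℝ) :
    reEstimate a θ η N = θ + ∑ j, classMean d (rtLength d N) η j • a j := by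
  rw [reEstimate_eq_rtEstimate, rtEstimate_eq_sum hd hN (by simp) a.orthonormal]
  · simp_rw [add_smul]
    rw [Finset.sum_add_distrib, a.sum_repr']
  · have h1 := a.toBasis.span_eq
    rw [OrthonormalBasis.coe_toBasis] at h1
    rw [h1, eq_comm, eq_top_iff]
    intro v _
    rw [mem_span_colVec_iff]
    exact ⟨v.ofLp, by simp⟩

lemma norm_reEstimate_sub_sq {N : ℕ} (hd : 0 < d) (hN : 1 ≤ N)
    (a : OrthonormalBasis (Fin d) ℝ (Vec d)) (θ : Vec d) (η : ℕ → ℝ) :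
    ‖reEstimate a θ η N - θ‖ ^ 2 = ∑ j, classMean d (rtLength d N) η j ^ 2 := by
  rw [reEstimate_eq_add_sum hd hN, add_sub_cancel_left, ← real_inner_self_eq_norm_sq,
    a.orthonormal.inner_sum]
  simp [sq]

/-- The part of `θ` orthogonal to an orthonormal family. -/
def residual (a : Fin k → Vec d) (θ : Vec d) : Vec d := θ - ∑ j, inner ℝ (a j) θ • a j

lemma inner_residual {a : Fin k → Vec d} (ha : Orthonormal ℝ a) (θ : Vec d) (j : Fin k) :
    inner ℝ (a j) (residual a θ) = 0 := by
  rw [residual, inner_sub_right, ha.inner_right_fintype, sub_self]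

lemma inner_residual_self {a : Fin k → Vec d} (ha : Orthonormal ℝ a) (θ : Vec d) :
    inner ℝ (residual a θ) θ = ‖residual a θ‖ ^ 2 := by
  have h : θ = residual a θ + ∑ j, inner ℝ (a j) θ • a j := by simp [residual]
  conv_lhs => rw [h]
  have h0 : inner ℝ (residual a θ) (∑ j, inner ℝ (a j) θ • a j) = 0 := by
    rw [inner_sum]
    refine Finset.sum_eq_zero fun j _ => ?_
    rw [inner_smul_right, real_inner_comm (a j) (residual a θ), inner_residual ha, mul_zero]
  rw [← h, ← real_inner_self_eq_norm_sq]
  conv_lhs => rw [h]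
  rw [inner_add_right, ← h, h0, add_zero]

lemma norm_residual_le {a : Fin k → Vec d} (ha : Orthonormal ℝ a) (θ : Vec d) :
    ‖residual a θ‖ ≤ ‖θ‖ := by
  have h := real_inner_le_norm (residual a θ) θ
  rw [inner_residual_self ha] at h
  by_contra! hc
  nlinarith [norm_nonneg θ, norm_nonneg (residual a θ)]

/-- The noise coordinates do not depend on the orthonormal family, so neither does the norm of the
noise part. Hence no independence between `Bhat` and the noise of the current task is needed. -/
lemma norm_rtEstimate_sub_sq_le {N : ℕ} (hk : 0 < k) (hN : 1 ≤ N)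
    {A : Matrix (Fin d) (Fin k) ℝ} (hA : Aᵀ * A = 1) {a : Fin k → Vec d} (ha : Orthonormal ℝ a)
    (hspan : Submodule.span ℝ (Set.range a) = Submodule.span ℝ (Set.range (colVec A)))
    (θ : Vec d) (η : ℕ → ℝ) :
    ‖rtEstimate A a θ η N - θ‖ ^ 2 ≤
      2 * ∑ j, classMean k (rtLength k N) η j ^ 2 + 2 * ‖residual a θ‖ ^ 2 := by
  have h1 : rtEstimate A a θ η N - θ =
      ∑ j, classMean k (rtLength k N) η j • a j - residual a θ := by
    rw [rtEstimate_eq_sum hk hN hA ha hspan, residual]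
    simp_rw [add_smul]
    rw [Finset.sum_add_distrib]; abel
  have h2 : ‖∑ j, classMean k (rtLength k N) η j • a j‖ ^ 2 =
      ∑ j, classMean k (rtLength k N) η j ^ 2 := by
    rw [← real_inner_self_eq_norm_sq, ha.inner_sum]
    simp [sq]
  rw [h1, ← h2]
  set x := ∑ j, classMean k (rtLength k N) η j • a j
  have h3 := norm_sub_le x (residual a θ)
  nlinarith [sq_nonneg (‖x‖ - ‖residual a θ‖), norm_nonneg (x - residual a θ), norm_nonneg x,
    norm_nonneg (residual a θ)]

lemma inner_colVec_residual {A : Matrix (Fin d) (Fin k) ℝ} {a : Fin k → Vec d}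
    (ha : Orthonormal ℝ a)
    (hspan : Submodule.span ℝ (Set.range a) = Submodule.span ℝ (Set.range (colVec A)))
    (θ : Vec d) (j : Fin k) : inner ℝ (colVec A j) (residual a θ) = 0 := by
  have hj : colVec A j ∈ Submodule.span ℝ (Set.range a) := by
    rw [hspan]; exact Submodule.subset_span ⟨j, rfl⟩
  generalize colVec A j = x at hj ⊢
  induction hj using Submodule.span_induction with
  | mem x hx => obtain ⟨j, rfl⟩ := hx; exact inner_residual ha θ j
  | zero => simp
  | add x y _ _ hx hy => rw [inner_add_left, hx, hy, add_zero]
  | smul c x _ hx => rw [inner_smul_left, hx, mul_zero]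

end Estimates

/-! ### Counting tasks and cycles. -/

section Cycles

variable {L : ℕ}

lemma two_mul_cycleStart (L n : ℕ) : 2 * cycleStart L n = L * (n * n + 3 * n) := by
  induction n with
  | zero => simp [cycleStart]
  | succ n ih => rw [cycleStart]; linear_combination ih

lemma cycleStart_strictMono (hL : 1 ≤ L) : StrictMono (cycleStart L) :=
  strictMono_nat_of_lt_succ fun n => by rw [cycleStart]; omega

lemma cycleStart_cycleOf_le (L s : ℕ) : cycleStart L (cycleOf L s) ≤ s :=
  Nat.findGreatest_spec (P := fun n => cycleStart L n ≤ s) (Nat.zero_le s) (Nat.zero_le s)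

lemma lt_cycleStart_cycleOf_succ (hL : 1 ≤ L) (s : ℕ) : s < cycleStart L (cycleOf L s + 1) := by
  by_contra! h
  -- The search in `cycleOf` stops at `s`; this loses nothing, as `n ≤ cycleStart L n`.
  have h1 : cycleOf L s + 1 ≤ cycleOf L s :=
    Nat.le_findGreatest (P := fun n => cycleStart L n ≤ s)
      (((cycleStart_strictMono hL).le_apply).trans h) h
  omega

lemma cycleOf_eq (hL : 1 ≤ L) {n s : ℕ} (h1 : cycleStart L n ≤ s) (h2 : s < cycleStart L (n + 1)) :
    cycleOf L s = n := by
  have h3 := cycleStart_cycleOf_le L s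
  have h4 := lt_cycleStart_cycleOf_succ hL s
  have h5 := (cycleStart_strictMono hL).lt_iff_lt.mp (h3.trans_lt h2)
  have h6 := (cycleStart_strictMono hL).lt_iff_lt.mp (h1.trans_lt h4)
  omega

open Classical in
/-- The weight `1` for tasks played with RE, and `1 / n` for tasks played with RT in the `n`-th
cycle. -/
def taskWeight (L s : ℕ) : ℝ := if InREPhase L s then 1 else 1 / (cycleOf L s + 1)

lemma taskWeight_nonneg (L s : ℕ) : 0 ≤ taskWeight L s := by
  unfold taskWeight; split_ifs <;> positivity

lemma sum_taskWeight_cycleStart (hL : 1 ≤ L) (n : ℕ) :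
    ∑ s ∈ Finset.range (cycleStart L n), taskWeight L s = 2 * L * n := by
  induction n with
  | zero => simp [cycleStart]
  | succ n ih =>
    have hc : ∀ j < L + (n + 1) * L, cycleOf L (cycleStart L n + j) = n := fun j hj =>
      cycleOf_eq hL (Nat.le_add_right _ _) (by rw [cycleStart]; omega)
    rw [cycleStart, Finset.sum_range_add, ih, Finset.sum_range_add]
    have h1 : ∑ j ∈ Finset.range L, taskWeight L (cycleStart L n + j) = L := by
      rw [Finset.sum_congr rfl (g := fun _ => (1 : ℝ))]
      · simp
      · intro j hj
        have hj := Finset.mem_range.mp hj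
        rw [taskWeight, InREPhase, hc j (by omega), if_pos (by omega)]
    have h2 : ∑ j ∈ Finset.range ((n + 1) * L), taskWeight L (cycleStart L n + (L + j)) = L := by
      rw [Finset.sum_congr rfl (g := fun _ => 1 / ((n : ℝ) + 1))]
      · simp
        field_simp
      · intro j hj
        have hj := Finset.mem_range.mp hj
        rw [taskWeight, InREPhase, hc (L + j) (by omega), if_neg (by omega)]
    rw [h1, h2]
    push_cast
    ring

/-- The last, possibly incomplete cycle `c` is counted in full, so the total weight is at most `2L(c
+ 1)`, while quadratic growth of `cycleStart` bounds `c` in terms of `τ`. -/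
lemma sum_taskWeight_sq_le (hL : 1 ≤ L) {τ : ℕ} (hτ : 1 ≤ τ) :
    (∑ s ∈ Finset.range τ, taskWeight L s) ^ 2 ≤ 4 * (2 * (τ : ℝ) * L + (L : ℝ) ^ 2) := by
  set c := cycleOf L (τ - 1)
  have h1 : cycleStart L c ≤ τ := (cycleStart_cycleOf_le L _).trans (Nat.sub_le _ _)
  have h2 : τ ≤ cycleStart L (c + 1) := by
    have := lt_cycleStart_cycleOf_succ hL (τ - 1)
    change _ < cycleStart L (c + 1) at this
    omega
  have h3 : ∑ s ∈ Finset.range τ, taskWeight L s ≤ 2 * L * (c + 1) := by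
    have := Finset.sum_le_sum_of_subset_of_nonneg (Finset.range_subset_range.mpr h2)
      (fun s _ _ => taskWeight_nonneg L s)
    rw [sum_taskWeight_cycleStart hL] at this
    exact_mod_cast this
  -- From `L(c² + 3c) = 2 * cycleStart L c ≤ 2τ` and `(c + 1)² ≤ c² + 3c + 1`.
  have h4 : L * (c + 1) ^ 2 ≤ 2 * τ + L := by
    have h5 := two_mul_cycleStart L c
    rcases Nat.eq_zero_or_pos c with h0 | h0
    · rw [h0]; omega
    · have : L * (c + 1) ^ 2 ≤ L * (c * c + 3 * c) + L :=
        calc L * (c + 1) ^ 2 ≤ L * (c * c + 3 * c + 1) := by gcongr; nlinarith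
          _ = _ := by ring
      omega
  have h4' : (L : ℝ) * (c + 1) ^ 2 ≤ 2 * τ + L := by exact_mod_cast h4
  have h0 : 0 ≤ ∑ s ∈ Finset.range τ, taskWeight L s :=
    Finset.sum_nonneg fun s _ => taskWeight_nonneg L s
  calc (∑ s ∈ Finset.range τ, taskWeight L s) ^ 2 ≤ (2 * (L : ℝ) * (c + 1)) ^ 2 := by gcongr
    _ = 4 * ((L : ℝ) * (L * (c + 1) ^ 2)) := by ring
    _ ≤ 4 * ((L : ℝ) * (2 * τ + L)) := by gcongr
    _ = _ := by ring

/-- The `j`-th task of the RE phase of cycle `m`. -/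
def reTask (L : ℕ) {n : ℕ} (p : Fin n × Fin L) : ℕ := cycleStart L p.1 + p.2

lemma reTask_injective (n : ℕ) : Function.Injective (reTask L (n := n)) := by
  intro p q hpq
  have hL : 1 ≤ L := by have := p.2.2; omega
  have hc : ∀ p : Fin n × Fin L, cycleOf L (reTask L p) = p.1 := fun p =>
    cycleOf_eq hL (Nat.le_add_right _ _) (by rw [cycleStart, reTask]; have := p.2.2; omega)
  have h1 : (p.1 : ℕ) = q.1 := by rw [← hc p, ← hc q, hpq]
  have h2 : (p.2 : ℕ) = q.2 := by
    simp only [reTask, h1] at hpq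
    omega
  exact Prod.ext (Fin.ext h1) (Fin.ext h2)

lemma cycleStart_add_le_of_not_inREPhase {s m : ℕ} (hL : 1 ≤ L) (hs : ¬ InREPhase L s)
    (hm : m ≤ cycleOf L s) : cycleStart L m + L ≤ s := by
  have := (cycleStart_strictMono hL).monotone hm
  unfold InREPhase at hs
  omega

end Cycles

/-! ### Pathwise regret of a task and error of the representation. -/

section Actions

variable {d r : ℕ} (ρ : Rules d r) (L N : ℕ) (θ : ℕ → Vec d)

lemma norm_greedy_le (v : Vec d) : ‖ρ.greedy v‖ ≤ 1 := by
  simpa [actionSet] using (ρ.greedy_spec v).1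

lemma bHat_transpose_mul_self (η : ℕ → ℕ → ℝ) (n : ℕ) :
    (bHat ρ L N θ η n)ᵀ * bHat ρ L N θ η n = 1 :=
  (ρ.topVectors_spec _).transpose_mul_self

lemma orthonormal_rtBasis_bHat (η : ℕ → ℕ → ℝ) (s n : ℕ) :
    Orthonormal ℝ (ρ.rtBasis s (bHat ρ L N θ η n)) :=
  ρ.rtBasis_orthonormal _ _ (bHat_transpose_mul_self ρ L N θ η n)

lemma norm_action_le (η : ℕ → ℕ → ℝ) (s t : ℕ) : ‖action ρ L N θ η s t‖ ≤ 1 := by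
  unfold action
  dsimp only
  split_ifs
  · exact norm_cyclicAction_le (ρ.reBasis s).norm_eq_one t
  · exact norm_greedy_le ρ _
  · exact norm_cyclicAction_le (orthonormal_rtBasis_bHat ρ L N θ η s _).1 t
  · exact norm_greedy_le ρ _

lemma pHat_eq_sum (η : ℕ → ℕ → ℝ) (n : ℕ) :
    pHat ρ L N θ η n = ∑ p : Fin (n + 1) × Fin L,
      Matrix.vecMulVec
        (reEstimate (ρ.reBasis (reTask L p)) (θ (reTask L p)) (η (reTask L p)) N : Fin d → ℝ)
        (reEstimate (ρ.reBasis (reTask L p)) (θ (reTask L p)) (η (reTask L p)) N) := by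
  rw [pHat, Fintype.sum_prod_type, Finset.sum_range]
  refine Finset.sum_congr rfl fun m _ => ?_
  rw [Finset.sum_range]
  rfl

/-- The regret of a task in which exploration of length `M` is followed by greedy play. -/
lemma sum_regret_le {M : ℕ} {x : ℕ → Vec d} {θ v : Vec d} (hx : ∀ t, ‖x t‖ ≤ 1)
    (hxg : ∀ t, M ≤ t → x t = ρ.greedy v) {φmin φmax : ℝ} (hmin : 0 < φmin) (h1 : φmin ≤ ‖θ‖)
    (h2 : ‖θ‖ ≤ φmax) :
    ∑ t ∈ Finset.range N, inner ℝ (ρ.greedy θ - x t) θ ≤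
      2 * φmax * M + N * (2 / φmin) * ‖v - θ‖ ^ 2 := by
  have hθ : 0 < ‖θ‖ := hmin.trans_le h1
  have hpt : ∀ t, inner ℝ (ρ.greedy θ - x t) θ ≤
      (if t < M then 2 * φmax else 0) + 2 / φmin * ‖v - θ‖ ^ 2 := by
    intro t
    split_ifs with ht
    · have h3 : ‖ρ.greedy θ - x t‖ ≤ 2 := by
        have := norm_sub_le (ρ.greedy θ) (x t)
        have := norm_greedy_le ρ θ
        have := hx t
        linarith
      have h4 := real_inner_le_norm (ρ.greedy θ - x t) θ
      have h5 : 0 ≤ 2 / φmin * ‖v - θ‖ ^ 2 := by positivity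
      nlinarith [mul_le_mul h3 h2 hθ.le zero_le_two]
    · rw [hxg t (not_lt.mp ht), zero_add]
      have h3 := inner_greedy_sub_mul_norm_le (ρ.greedy_spec v) (ρ.greedy_spec θ)
      calc inner ℝ (ρ.greedy θ - ρ.greedy v) θ ≤ 2 * ‖v - θ‖ ^ 2 / ‖θ‖ := by
            rwa [le_div_iff₀ hθ]
        _ ≤ 2 * ‖v - θ‖ ^ 2 / φmin := by gcongr
        _ = _ := by ring
  refine (Finset.sum_le_sum fun t _ => hpt t).trans ?_
  rw [Finset.sum_add_distrib, Finset.sum_const, Finset.card_range, nsmul_eq_mul]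
  refine add_le_add ?_ (le_of_eq (by ring))
  rw [← Finset.sum_filter, Finset.sum_const, nsmul_eq_mul, mul_comm]
  refine mul_le_mul_of_nonneg_left ?_ (by linarith)
  have : (Finset.range N).filter (· < M) ⊆ Finset.range M := fun t ht =>
    Finset.mem_range.mpr (Finset.mem_filter.mp ht).2
  exact_mod_cast (Finset.card_le_card this).trans (Finset.card_range M).le

/-- The regret incurred in task `s`. -/
def taskRegret (η : ℕ → ℕ → ℝ) (s : ℕ) : ℝ :=
  ∑ t ∈ Finset.range N, inner ℝ (ρ.greedy (θ s) - action ρ L N θ η s t) (θ s)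

variable {L N θ}

lemma taskRegret_le_of_inREPhase (hd : 0 < d) (hN : 1 ≤ N) (η : ℕ → ℕ → ℝ) {s : ℕ}
    (hs : InREPhase L s) {φmin φmax : ℝ} (hmin : 0 < φmin) (h1 : φmin ≤ ‖θ s‖)
    (h2 : ‖θ s‖ ≤ φmax) :
    taskRegret ρ L N θ η s ≤ 2 * φmax * rtLength d N +
      N * (2 / φmin) * ∑ j : Fin d, classMean d (rtLength d N) (η s) j ^ 2 := by
  rw [← norm_reEstimate_sub_sq hd hN (ρ.reBasis s) (θ s)]
  refine sum_regret_le ρ N (norm_action_le ρ L N θ η s) (fun t ht => ?_) hmin h1 h2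
  rw [action, if_pos hs]
  exact if_neg (not_lt.mpr ht)

lemma taskRegret_le_of_not_inREPhase (hr : 0 < r) (hN : 1 ≤ N) (η : ℕ → ℕ → ℝ) {s : ℕ}
    (hs : ¬ InREPhase L s) {φmin φmax : ℝ} (hmin : 0 < φmin) (h1 : φmin ≤ ‖θ s‖)
    (h2 : ‖θ s‖ ≤ φmax) :
    taskRegret ρ L N θ η s ≤ 2 * φmax * rtLength r N +
      N * (2 / φmin) * (2 * ∑ j : Fin r, classMean r (rtLength r N) (η s) j ^ 2 +
        2 * ‖residual (ρ.rtBasis s (bHat ρ L N θ η (cycleOf L s))) (θ s)‖ ^ 2) := by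
  refine (sum_regret_le ρ N (norm_action_le ρ L N θ η s)
    (M := rtLength r N) (v := rtEstimate (bHat ρ L N θ η (cycleOf L s))
      (ρ.rtBasis s (bHat ρ L N θ η (cycleOf L s))) (θ s) (η s) N)
    (fun t ht => ?_) hmin h1 h2).trans ?_
  · rw [action, if_neg hs]
    dsimp only
    rw [if_neg (not_lt.mpr ht)]
  · gcongr
    exact norm_rtEstimate_sub_sq_le hr hN (bHat_transpose_mul_self ρ L N θ η _)
      (orthonormal_rtBasis_bHat ρ L N θ η s _)
      (ρ.rtBasis_span _ _ (bHat_transpose_mul_self ρ L N θ η _)) _ _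

/-- Deterministic bound on the error of the estimated representation. -/
lemma residual_rtBasis_le (hd : 0 < d) (hN : 1 ≤ N) (hr : 1 ≤ r) (η : ℕ → ℕ → ℝ)
    (S : Submodule ℝ (Vec d)) (hS : Module.finrank ℝ S ≤ r) {n s : ℕ} (hθs : θ s ∈ S)
    (hθ : ∀ p : Fin (n + 1) × Fin L, θ (reTask L p) ∈ S) {ν K : ℝ} (hν : 0 < ν) (hK : 0 ≤ K)
    (hwin : ∀ m : Fin (n + 1), ν ≤ singularValue r
      (windowMatrix θ (cycleStart L m) L * (windowMatrix θ (cycleStart L m) L)ᵀ))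
    (hgram : ∀ v : Vec d, ∑ p : Fin (n + 1) × Fin L,
      inner ℝ (∑ j, classMean d (rtLength d N) (η (reTask L p)) j • ρ.reBasis (reTask L p) j) v ^ 2
        ≤ K * ‖v‖ ^ 2) :
    (n + 1) * ν * ‖residual (ρ.rtBasis s (bHat ρ L N θ η n)) (θ s)‖ ^ 2 ≤
      4 * K * ‖θ s‖ ^ 2 := by
  set A := bHat ρ L N θ η n with hA
  have hAA : Aᵀ * A = 1 := bHat_transpose_mul_self ρ L N θ η n
  have ha := ρ.rtBasis_orthonormal s A hAA
  set q := residual (ρ.rtBasis s A) (θ s) with hq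
  let e : Fin (n + 1) × Fin L → Vec d := fun p =>
    ∑ j, classMean d (rtLength d N) (η (reTask L p)) j • ρ.reBasis (reTask L p) j
  have htop : IsTopSingularVectors (∑ p : Fin (n + 1) × Fin L,
      Matrix.vecMulVec (θ (reTask L p) + e p : Vec d).ofLp (θ (reTask L p) + e p).ofLp) A := by
    have h := ρ.topVectors_spec (pHat ρ L N θ η n)
    rw [pHat_eq_sum] at h
    rw [hA, bHat, pHat_eq_sum]
    simp only [reEstimate_eq_add_sum hd hN] at h ⊢
    exact h
  refine mul_norm_sq_le_of_gram S hθ hK (by positivity) (fun z hz => ?_) (hgram q)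
    (htop.gram_le S hS (fun w hw => ?_) fun j => ?_) hθs (inner_residual_self ha _)
  -- Each of the `n + 1` RE phases is a window of `L` consecutive tasks and contributes `ν`.
  · rw [Fintype.sum_prod_type]
    calc (n + 1) * ν * ‖z‖ ^ 2 = ∑ m : Fin (n + 1), ν * ‖z‖ ^ 2 := by
          rw [Finset.sum_const, Finset.card_univ, Fintype.card_fin, nsmul_eq_mul]
          push_cast; ring
      _ ≤ _ := Finset.sum_le_sum fun m _ => mul_norm_sq_le_window S hS hr
          (fun j hj => hθ (m, ⟨j, hj⟩)) hν (hwin m) hz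
  -- On `Sᗮ` the tasks vanish and only the errors remain, so the same `K` serves both forms.
  · refine le_trans (le_of_eq ?_) (hgram w)
    refine Finset.sum_congr rfl fun p _ => ?_
    rw [inner_add_left, (Submodule.mem_orthogonal S w).mp hw _ (hθ p), zero_add]
  · exact inner_colVec_residual ha (ρ.rtBasis_span _ _ hAA) _ _

end Actions

/-! ### Measurability and expected regret of a task. -/

section Expectation

variable {Ω : Type*} [MeasurableSpace Ω] {μ : Measure Ω} {d r L N τ : ℕ}
  {η : ℕ → ℕ → Ω → ℝ} (ρ : Rules d r) {θ : ℕ → Vec d}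

lemma measurable_reEstimate (hd : 0 < d) (hN : 1 ≤ N) (hdN : rtLength d N ≤ N)
    (hm : ∀ s < τ, ∀ t < N, Measurable (η s t)) {s : ℕ} (hs : s < τ)
    (a : OrthonormalBasis (Fin d) ℝ (Vec d)) (v : Vec d) :
    Measurable fun ω => reEstimate a v (fun t => η s t ω) N := by
  simp only [reEstimate_eq_add_sum hd hN]
  refine measurable_const.add (Finset.measurable_fun_sum _ fun j _ => ?_)
  exact (measurable_classMean (fun t ht => hm s hs t (ht.trans_le hdN)) j).smul_const _

lemma measurable_bHat (hd : 0 < d) (hN : 1 ≤ N) (hdN : rtLength d N ≤ N)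
    (hm : ∀ s < τ, ∀ t < N, Measurable (η s t)) {n : ℕ}
    (hn : ∀ p : Fin (n + 1) × Fin L, reTask L p < τ) (i : Fin d) (j : Fin r) :
    Measurable fun ω => bHat ρ L N θ (fun s t => η s t ω) n i j := by
  have h : Measurable fun ω => fun a b => pHat ρ L N θ (fun s t => η s t ω) n a b := by
    refine measurable_pi_iff.mpr fun a => measurable_pi_iff.mpr fun b => ?_
    simp only [pHat_eq_sum, Matrix.sum_apply, Matrix.vecMulVec_apply]
    refine Finset.measurable_fun_sum _ fun p _ => ?_
    have h1 := measurable_reEstimate hd hN hdN hm (hn p) (ρ.reBasis (reTask L p)) (θ (reTask L p))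
    exact ((measurable_pi_apply a).comp (WithLp.measurable_ofLp 2 _ |>.comp h1)).mul
      ((measurable_pi_apply b).comp (WithLp.measurable_ofLp 2 _ |>.comp h1))
  exact (ρ.topVectors_measurable i j).comp h

lemma measurable_rtBasis_bHat (hd : 0 < d) (hN : 1 ≤ N) (hdN : rtLength d N ≤ N)
    (hm : ∀ s < τ, ∀ t < N, Measurable (η s t)) {n : ℕ}
    (hn : ∀ p : Fin (n + 1) × Fin L, reTask L p < τ) (s : ℕ) (j : Fin r) :
    Measurable fun ω => ρ.rtBasis s (bHat ρ L N θ (fun s t => η s t ω) n) j :=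
  (ρ.rtBasis_measurable s j).comp (measurable_pi_iff.mpr fun i => measurable_pi_iff.mpr fun j =>
    measurable_bHat ρ hd hN hdN hm hn i j)

/-- The closed form in the explored basis contains no matrix inverse, so measurability reduces to
that of the basis and of the class means. -/
lemma measurable_rtEstimate_bHat (hd : 0 < d) (hr : 0 < r) (hN : 1 ≤ N)
    (hdN : rtLength d N ≤ N) (hrN : rtLength r N ≤ N)
    (hm : ∀ s < τ, ∀ t < N, Measurable (η s t)) {n s : ℕ}
    (hn : ∀ p : Fin (n + 1) × Fin L, reTask L p < τ) (hs : s < τ) (v : Vec d) :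
    Measurable fun ω => rtEstimate (bHat ρ L N θ (fun s t => η s t ω) n)
      (ρ.rtBasis s (bHat ρ L N θ (fun s t => η s t ω) n)) v (fun t => η s t ω) N := by
  have hA := fun ω => bHat_transpose_mul_self ρ L N θ (fun s t => η s t ω) n
  simp only [fun ω => rtEstimate_eq_sum hr hN (hA ω) (ρ.rtBasis_orthonormal s _ (hA ω))
    (ρ.rtBasis_span s _ (hA ω))]
  refine Finset.measurable_fun_sum _ fun j _ => ?_
  have h1 := measurable_rtBasis_bHat ρ (θ := θ) hd hN hdN hm hn s j
  exact ((h1.inner measurable_const).add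
    (measurable_classMean (fun t ht => hm s hs t (ht.trans_le hrN)) j)).smul h1

lemma reTask_lt {s : ℕ} (hs : ¬ InREPhase L s) (hsτ : s < τ)
    (p : Fin (cycleOf L s + 1) × Fin L) : reTask L p < τ := by
  have hL := p.2.2
  have := cycleStart_add_le_of_not_inREPhase (by omega) hs (Nat.lt_succ_iff.mp p.1.2)
  rw [reTask]
  omega

lemma measurable_action (hd : 0 < d) (hr : 0 < r) (hN : 1 ≤ N)
    (hdN : rtLength d N ≤ N) (hrN : rtLength r N ≤ N)
    (hm : ∀ s < τ, ∀ t < N, Measurable (η s t)) {s : ℕ} (hs : s < τ) (t : ℕ) :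
    Measurable fun ω => action ρ L N θ (fun s t => η s t ω) s t := by
  unfold action
  by_cases hRE : InREPhase L s
  · simp only [if_pos hRE]
    split_ifs
    · exact measurable_const
    · exact ρ.greedy_measurable.comp (measurable_reEstimate hd hN hdN hm hs _ _)
  · simp only [if_neg hRE]
    split_ifs
    · simp only [cyclicAction_eq hr]
      exact measurable_rtBasis_bHat ρ hd hN hdN hm (reTask_lt hRE hs) s _
    · exact ρ.greedy_measurable.comp
        (measurable_rtEstimate_bHat ρ hd hr hN hdN hrN hm (reTask_lt hRE hs) hs _)

lemma integrable_taskRegret [IsProbabilityMeasure μ] (hd : 0 < d) (hr : 0 < r) (hN : 1 ≤ N)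
    (hdN : rtLength d N ≤ N) (hrN : rtLength r N ≤ N)
    (hm : ∀ s < τ, ∀ t < N, Measurable (η s t)) {s : ℕ} (hs : s < τ) :
    Integrable (fun ω => taskRegret ρ L N θ (fun s t => η s t ω) s) μ := by
  refine integrable_finsetSum _ fun t _ => ?_
  refine Integrable.of_bound (C := 2 * ‖θ s‖)
    ((measurable_const.sub (measurable_action ρ hd hr hN hdN hrN hm hs t)).inner
      measurable_const).aestronglyMeasurable (ae_of_all _ fun ω => ?_)
  refine (norm_inner_le_norm _ _).trans (mul_le_mul_of_nonneg_right ?_ (norm_nonneg _))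
  have h1 := norm_sub_le (ρ.greedy (θ s)) (action ρ L N θ (fun s t => η s t ω) s t)
  have h2 := norm_greedy_le ρ (θ s)
  have h3 := norm_action_le ρ L N θ (fun s t => η s t ω) s t
  linarith

lemma iIndepFun_tasks {ι : Type*} {M : ℕ}
    (hind : iIndepFun (fun (p : Fin τ × Fin N) ω => η p.1 p.2 ω) μ) (hM : M ≤ N) {s : ι → ℕ}
    (hs : Function.Injective s) (hsτ : ∀ i, s i < τ) :
    iIndepFun (fun p : ι × Fin M => η (s p.1) p.2) μ := by
  refine hind.precomp (g := fun p : ι × Fin M => (⟨s p.1, hsτ p.1⟩, ⟨p.2, p.2.2.trans_le hM⟩))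
    fun p q hpq => ?_
  simp only [Prod.mk.injEq, Fin.mk.injEq] at hpq
  exact Prod.ext (hs hpq.1) (Fin.ext hpq.2)

lemma integral_sum_classMean_task_le [IsProbabilityMeasure μ] {k : ℕ} (hk : 0 < k) (hN : 1 ≤ N)
    (hkN : rtLength k N ≤ N) (hX : ∀ s < τ, ∀ t < N, HasSubgaussianMGF (η s t) 1 μ)
    (hind : iIndepFun (fun (p : Fin τ × Fin N) ω => η p.1 p.2 ω) μ) {s : ℕ} (hs : s < τ) :
    Integrable (fun ω => ∑ j : Fin k, classMean k (rtLength k N) (fun t => η s t ω) j ^ 2) μ ∧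
    ∫ ω, ∑ j : Fin k, classMean k (rtLength k N) (fun t => η s t ω) j ^ 2 ∂μ ≤
      k * (4 / √(N : ℝ)) := by
  refine integral_sum_classMean_sq_le hk hN ?_ fun t ht => hX s hs t (ht.trans_le hkN)
  exact (iIndepFun_tasks (ι := Unit) hind hkN (s := fun _ => s) (fun _ _ _ => rfl)
    (fun _ => hs)).precomp (g := fun t => ((), t)) fun _ _ h => (Prod.mk.inj h).2

lemma mul_div_sqrt (hN : 1 ≤ N) (k c : ℝ) : (N : ℝ) * (k * (c / √(N : ℝ))) = c * (k * √(N : ℝ)) := by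
  have hs : √(N : ℝ) ≠ 0 := (Real.sqrt_pos.mpr (by exact_mod_cast hN)).ne'
  have hN2 : (N : ℝ) = √(N : ℝ) * √(N : ℝ) := (Real.mul_self_sqrt (Nat.cast_nonneg N)).symm
  calc (N : ℝ) * (k * (c / √(N : ℝ))) = √(N : ℝ) * √(N : ℝ) * (k * (c / √(N : ℝ))) := by rw [← hN2]
    _ = _ := by field_simp

lemma integral_taskRegret_le_of_inREPhase [IsProbabilityMeasure μ] (hd : 0 < d) (hr : 0 < r)
    (hN : 1 ≤ N) (hdN : rtLength d N ≤ N) (hrN : rtLength r N ≤ N)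
    (hm : ∀ s < τ, ∀ t < N, Measurable (η s t))
    (hX : ∀ s < τ, ∀ t < N, HasSubgaussianMGF (η s t) 1 μ)
    (hind : iIndepFun (fun (p : Fin τ × Fin N) ω => η p.1 p.2 ω) μ) {s : ℕ} (hs : s < τ)
    (hRE : InREPhase L s) {φmin φmax : ℝ} (hmin : 0 < φmin) (h1 : φmin ≤ ‖θ s‖)
    (h2 : ‖θ s‖ ≤ φmax) :
    ∫ ω, taskRegret ρ L N θ (fun s t => η s t ω) s ∂μ ≤
      (4 * φmax + 8 / φmin) * (d * √(N : ℝ)) := by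
  obtain ⟨hi, hI⟩ := integral_sum_classMean_task_le hd hN hdN hX hind hs
  have hφ : 0 ≤ φmax := by linarith
  calc _ ≤ ∫ ω, (2 * φmax * rtLength d N + N * (2 / φmin) *
        ∑ j : Fin d, classMean d (rtLength d N) (fun t => η s t ω) j ^ 2) ∂μ :=
        integral_mono (integrable_taskRegret ρ hd hr hN hdN hrN hm hs)
          ((integrable_const _).add (hi.const_mul _))
          fun ω => taskRegret_le_of_inREPhase ρ hd hN _ hRE hmin h1 h2
    _ ≤ 2 * φmax * (2 * (d * √(N : ℝ))) + N * (2 / φmin) * (d * (4 / √(N : ℝ))) := by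
        rw [integral_add (integrable_const _) (hi.const_mul _), integral_const, probReal_univ,
          one_smul, integral_const_mul]
        gcongr
        exact rtLength_le_two_mul hd hN
    _ = 2 * φmax * (2 * (d * √(N : ℝ))) + (2 / φmin) * (N * (d * (4 / √(N : ℝ)))) := by ring
    _ = _ := by rw [mul_div_sqrt hN]; ring

lemma integrable_residual_sq [IsProbabilityMeasure μ] (hd : 0 < d) (hN : 1 ≤ N)
    (hdN : rtLength d N ≤ N) (hm : ∀ s < τ, ∀ t < N, Measurable (η s t)) {n : ℕ}
    (hn : ∀ p : Fin (n + 1) × Fin L, reTask L p < τ) (s : ℕ) (v : Vec d) :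
    Integrable (fun ω => ‖residual (ρ.rtBasis s (bHat ρ L N θ (fun s t => η s t ω) n)) v‖ ^ 2)
      μ := by
  have h1 := fun j => measurable_rtBasis_bHat ρ (θ := θ) hd hN hdN hm hn s j
  have h2 : Measurable fun ω =>
      residual (ρ.rtBasis s (bHat ρ L N θ (fun s t => η s t ω) n)) v :=
    measurable_const.sub (Finset.measurable_fun_sum _ fun j _ => by
      have h3 : Measurable fun ω =>
          (inner ℝ (ρ.rtBasis s (bHat ρ L N θ (fun s t => η s t ω) n) j) v : ℝ) :=
        (h1 j).inner measurable_const
      exact h3.smul (h1 j))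
  refine Integrable.of_bound (C := ‖v‖ ^ 2) (h2.norm.pow_const 2).aestronglyMeasurable
    (ae_of_all _ fun ω => ?_)
  rw [Real.norm_of_nonneg (by positivity)]
  have := norm_residual_le (orthonormal_rtBasis_bHat ρ L N θ (fun s t => η s t ω) s n) v
  gcongr

/-- Expected error of the estimated representation in cycle `n`. -/
lemma integral_residual_sq_le [IsProbabilityMeasure μ] (hd : 0 < d) (hN : 1 ≤ N) (hr : 1 ≤ r)
    (hdN : rtLength d N ≤ N) (hm : ∀ s < τ, ∀ t < N, Measurable (η s t))
    (hX : ∀ s < τ, ∀ t < N, HasSubgaussianMGF (η s t) 1 μ)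
    (hind : iIndepFun (fun (p : Fin τ × Fin N) ω => η p.1 p.2 ω) μ)
    (S : Submodule ℝ (Vec d)) (hS : Module.finrank ℝ S ≤ r) (hθ : ∀ s < τ, θ s ∈ S)
    {n s : ℕ} (hs : s < τ) (hn : ∀ p : Fin (n + 1) × Fin L, reTask L p < τ)
    {ν φmax : ℝ} (hν : 0 < ν) (h2 : ‖θ s‖ ≤ φmax)
    (hwin : ∀ m : Fin (n + 1), ν ≤ singularValue r
      (windowMatrix θ (cycleStart L m) L * (windowMatrix θ (cycleStart L m) L)ᵀ)) :
    ∫ ω, ‖residual (ρ.rtBasis s (bHat ρ L N θ (fun s t => η s t ω) n)) (θ s)‖ ^ 2 ∂μ ≤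
      256 / √(N : ℝ) * ((((n + 1) * L + d : ℕ) : ℝ) * Real.log 5 + Real.log N) * φmax ^ 2 /
        ((n + 1) * ν) + φmax ^ 2 / N := by
  set p : ℕ := (n + 1) * L + d with hp
  have hN' : (1 : ℝ) ≤ N := by exact_mod_cast hN
  have hs0 : 0 < √(N : ℝ) := Real.sqrt_pos.mpr (by linarith)
  have hφ : 0 ≤ φmax := (norm_nonneg _).trans h2
  have hQ : 0 ≤ (p : ℝ) * Real.log 5 + Real.log N :=
    add_nonneg (mul_nonneg (Nat.cast_nonneg _) (Real.log_nonneg (by norm_num)))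
      (Real.log_nonneg hN')
  set Q := (p : ℝ) * Real.log 5 + Real.log N with hQdef
  -- Chosen so that the tail is `e^{-Q}`; the term `p log 5` of `Q` cancels the `5 ^ p` net pairs
  -- and leaves failure probability `1/N`.
  set t : ℝ := √(4 / √(N : ℝ) * Q) with ht
  have ht2 : t ^ 2 = 4 / √(N : ℝ) * Q := Real.sq_sqrt (by positivity)
  obtain ⟨G, hG, hGc, hGv⟩ := exists_event_gram_le (μ := μ) hd hN
    (X := fun p : Fin (n + 1) × Fin L => η (reTask L p))
    (fun p t ht => hm _ (hn p) t (ht.trans_le hdN))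
    (iIndepFun_tasks hind hdN (reTask_injective (n + 1)) hn)
    (fun p t ht => hX _ (hn p) t (ht.trans_le hdN)) (fun p => ρ.reBasis (reTask L p))
    (t := t) (Real.sqrt_nonneg _)
  have hcard : Fintype.card (Fin (n + 1) × Fin L) + d = p := by simp [hp]
  have hprob : μ.real Gᶜ ≤ 1 / N := by
    refine hGc.trans (le_of_eq ?_)
    have h3 : -t ^ 2 / (2 * (2 / √(N : ℝ))) = -Q := by
      rw [ht2]; field_simp
      ring
    have h4 : (5 : ℝ) ^ p = Real.exp (p * Real.log 5) := by
      rw [Real.exp_nat_mul, Real.exp_log (by norm_num)]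
    rw [hcard, h3, h4, ← Real.exp_add, hQdef]
    have h5 : (p : ℝ) * Real.log 5 + -(p * Real.log 5 + Real.log N) = -Real.log N := by ring
    rw [h5, Real.exp_neg, Real.exp_log (by linarith), one_div]
  -- On the good event `K = 16 t²`, and `256 = 4 · 16 · 4`. Off it the residual is at most `‖θ s‖ ≤
  -- φmax`.
  refine (integral_le_add_mul_measure_compl hG (A := 256 / √(N : ℝ) * Q * φmax ^ 2 /
        ((n + 1) * ν)) (B := φmax ^ 2) (by positivity)
        (integrable_residual_sq ρ hd hN hdN hm hn s (θ s)) (fun ω hω => ?_) fun ω => ?_).trans ?_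
  · have h3 := residual_rtBasis_le ρ hd hN hr (fun s t => η s t ω) S hS (hθ s hs)
      (fun p => hθ _ (hn p)) hν (K := 16 * t ^ 2) (by positivity) hwin (hGv ω hω)
    rw [le_div_iff₀ (by positivity)]
    have h4 : ‖θ s‖ ^ 2 ≤ φmax ^ 2 := by gcongr
    calc _ = (n + 1) * ν *
        ‖residual (ρ.rtBasis s (bHat ρ L N θ (fun s t => η s t ω) n)) (θ s)‖ ^ 2 := by ring
      _ ≤ 4 * (16 * t ^ 2) * ‖θ s‖ ^ 2 := h3
      _ ≤ 4 * (16 * t ^ 2) * φmax ^ 2 := by gcongr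
      _ = _ := by rw [ht2]; ring
  · have := norm_residual_le
      (orthonormal_rtBasis_bHat ρ L N θ (fun s t => η s t ω) s n) (θ s)
    have := this.trans h2
    gcongr
  · have := mul_le_mul_of_nonneg_left hprob (sq_nonneg φmax)
    rw [mul_one_div] at this
    linarith

lemma integral_taskRegret_le_of_not_inREPhase [IsProbabilityMeasure μ] (hd : 0 < d) (hr : 1 ≤ r)
    (hN : 1 ≤ N) (hdN : rtLength d N ≤ N) (hrN : rtLength r N ≤ N)
    (hm : ∀ s < τ, ∀ t < N, Measurable (η s t))
    (hX : ∀ s < τ, ∀ t < N, HasSubgaussianMGF (η s t) 1 μ)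
    (hind : iIndepFun (fun (p : Fin τ × Fin N) ω => η p.1 p.2 ω) μ)
    (S : Submodule ℝ (Vec d)) (hS : Module.finrank ℝ S ≤ r) (hθ : ∀ s < τ, θ s ∈ S)
    {ν φmin φmax : ℝ} (hν : 0 < ν) (hmin : 0 < φmin) (hL : 1 ≤ L)
    (hwin : ∀ s, s + L ≤ τ → ν ≤ singularValue r (windowMatrix θ s L * (windowMatrix θ s L)ᵀ))
    {s : ℕ} (hs : s < τ) (hRT : ¬ InREPhase L s) (h1 : φmin ≤ ‖θ s‖) (h2 : ‖θ s‖ ≤ φmax)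
    (hτN : 2 ≤ τ) :
    ∫ ω, taskRegret ρ L N θ (fun s t => η s t ω) s ∂μ ≤
      (4 * φmax + 16 / φmin + 4 * φmax ^ 2 / φmin) * (r * √(N : ℝ)) +
        5120 * φmax ^ 2 / (φmin * ν) * Real.log ((τ : ℝ) * N) *
          (√(N : ℝ) * (L + d / (cycleOf L s + 1))) := by
  obtain ⟨hi, hI⟩ := integral_sum_classMean_task_le (k := r) hr hN hrN hX hind hs
  have hlt := reTask_lt hRT hs
  have hri := integrable_residual_sq (μ := μ) ρ (θ := θ) hd hN hdN hm hlt s (θ s)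
  have hrI := integral_residual_sq_le (μ := μ) ρ hd hN hr hdN hm hX hind S hS hθ hs hlt hν h2
    (fun m => hwin _ (by
      have := cycleStart_add_le_of_not_inREPhase hL hRT (Nat.lt_succ_iff.mp m.2)
      omega))
  set n := cycleOf L s with hn
  have hφ : 0 ≤ φmax := by linarith
  have hN' : (1 : ℝ) ≤ N := by exact_mod_cast hN
  have hs1 : 1 ≤ √(N : ℝ) := Real.one_le_sqrt.mpr hN'
  have hs0 : 0 < √(N : ℝ) := by linarith
  have hτ' : (2 : ℝ) ≤ τ := by exact_mod_cast hτN
  set ℓ := Real.log ((τ : ℝ) * N) with hℓ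
  have hℓ1 : 1 / 2 ≤ ℓ := by
    have := Real.log_two_gt_d9
    have := Real.log_le_log (by norm_num) (show (2 : ℝ) ≤ τ * N by nlinarith)
    linarith
  have hlogN : Real.log N ≤ ℓ := Real.log_le_log (by linarith) (by nlinarith)
  have hlog5 : Real.log 5 ≤ 2 := by
    rw [Real.log_le_iff_le_exp (by norm_num)]
    have h3 : Real.exp 2 = Real.exp 1 ^ 2 := by rw [← Real.exp_nat_mul]; norm_num
    have := Real.exp_one_gt_d9
    rw [h3]; nlinarith
  set p : ℝ := (((n + 1) * L + d : ℕ) : ℝ) with hp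
  have hp1 : 1 ≤ p := by
    rw [hp]; exact_mod_cast (by omega : 1 ≤ (n + 1) * L + d)
  -- `p log 5 ≤ 2p ≤ 4pℓ` since `ℓ ≥ 1/2`, and `log N ≤ ℓ ≤ pℓ`.
  have hQ : p * Real.log 5 + Real.log N ≤ 5 * p * ℓ := by
    have e1 : p * Real.log 5 ≤ p * 2 := by gcongr
    nlinarith [mul_le_mul_of_nonneg_right hp1 (by linarith : (0 : ℝ) ≤ ℓ)]
  have hpn : p / (n + 1) = L + d / ((n : ℝ) + 1) := by
    rw [hp]; push_cast
    field_simp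
  have hN2 : (N : ℝ) / √(N : ℝ) = √(N : ℝ) := Real.div_sqrt
  -- `5120 = 4 · 256 · 5`. The failure event contributes the constant `4 φmax² / φmin`, later
  -- absorbed through `1 ≤ r√N`.
  have hres : N * (4 / φmin) * (256 / √(N : ℝ) * (p * Real.log 5 + Real.log N) * φmax ^ 2 /
        ((n + 1) * ν) + φmax ^ 2 / N) ≤ 5120 * φmax ^ 2 / (φmin * ν) * ℓ *
          (√(N : ℝ) * (L + d / (n + 1))) + 4 * φmax ^ 2 / φmin := by
    calc _ ≤ N * (4 / φmin) * (256 / √(N : ℝ) * (5 * p * ℓ) * φmax ^ 2 /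
        ((n + 1) * ν) + φmax ^ 2 / N) := by gcongr
      _ = 5120 * φmax ^ 2 / (φmin * ν) * ℓ * ((N / √(N : ℝ)) * (p / (n + 1))) +
          4 * φmax ^ 2 / φmin := by field_simp; ring
      _ = _ := by rw [hN2, hpn]
  have hsum : Integrable (fun ω =>
      2 * ∑ j : Fin r, classMean r (rtLength r N) (fun t => η s t ω) j ^ 2 +
        2 * ‖residual (ρ.rtBasis s (bHat ρ L N θ (fun s t => η s t ω) n)) (θ s)‖ ^ 2) μ :=
    (hi.const_mul 2).add (hri.const_mul 2)
  have hrs : 1 ≤ r * √(N : ℝ) := by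
    have : (1 : ℝ) ≤ r := by exact_mod_cast hr
    nlinarith
  calc _ ≤ ∫ ω, (2 * φmax * rtLength r N + N * (2 / φmin) *
        (2 * ∑ j : Fin r, classMean r (rtLength r N) (fun t => η s t ω) j ^ 2 +
        2 * ‖residual (ρ.rtBasis s (bHat ρ L N θ (fun s t => η s t ω) n)) (θ s)‖ ^ 2)) ∂μ :=
        integral_mono (integrable_taskRegret ρ hd hr hN hdN hrN hm hs)
          ((integrable_const _).add (hsum.const_mul _))
          fun ω => taskRegret_le_of_not_inREPhase ρ hr hN _ hRT hmin h1 h2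
    _ = 2 * φmax * rtLength r N + N * (4 / φmin) *
        (∫ ω, ∑ j : Fin r, classMean r (rtLength r N) (fun t => η s t ω) j ^ 2 ∂μ) +
        N * (4 / φmin) * ∫ ω,
          ‖residual (ρ.rtBasis s (bHat ρ L N θ (fun s t => η s t ω) n)) (θ s)‖ ^ 2 ∂μ := by
        rw [integral_add (integrable_const _) (hsum.const_mul _), integral_const, probReal_univ,
          one_smul, integral_const_mul, integral_add (hi.const_mul 2) (hri.const_mul 2),
          integral_const_mul, integral_const_mul]
        ring
    _ ≤ 2 * φmax * (2 * (r * √(N : ℝ))) + N * (4 / φmin) * (r * (4 / √(N : ℝ))) +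
        (5120 * φmax ^ 2 / (φmin * ν) * ℓ *
          (√(N : ℝ) * (L + d / (n + 1))) + 4 * φmax ^ 2 / φmin) := by
        refine add_le_add (add_le_add ?_ ?_) ?_
        · gcongr
          exact rtLength_le_two_mul hr hN
        · gcongr
        · refine le_trans ?_ hres
          gcongr
    _ = 2 * φmax * (2 * (r * √(N : ℝ))) + (4 / φmin) * (N * (r * (4 / √(N : ℝ)))) +
        (5120 * φmax ^ 2 / (φmin * ν) * ℓ *
          (√(N : ℝ) * (L + d / (n + 1))) + 4 * φmax ^ 2 / φmin * 1) := by ring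
    _ ≤ 2 * φmax * (2 * (r * √(N : ℝ))) + (4 / φmin) * (4 * (r * √(N : ℝ))) +
        (5120 * φmax ^ 2 / (φmin * ν) * ℓ *
          (√(N : ℝ) * (L + d / (n + 1))) + 4 * φmax ^ 2 / φmin * (r * √(N : ℝ))) := by
        rw [mul_div_sqrt hN]
        gcongr
    _ = _ := by ring

end Expectation

end SeqBandit

end

/-! ### Summation over the tasks. -/

theorem theorem2 :
    ∃ k : ℕ, ∀ (φmin φmax ν c₁ : ℝ), 0 < φmin → φmin ≤ φmax → 0 < ν → 0 < c₁ →
      ∃ C : ℝ, 0 < C ∧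
        ∀ (d r N τ L : ℕ), 1 ≤ r → d ^ 2 ≤ N → r ^ 2 < τ → (L : ℝ) = c₁ * r →
        -- the tasks, with their common representation
        ∀ (B : Matrix (Fin d) (Fin r) ℝ) (θ : ℕ → SeqBandit.Vec d),
          Bᵀ * B = 1 →
          (∀ s < τ, ∃ α : Fin r → ℝ, θ s = WithLp.toLp 2 (B *ᵥ α)) →
          (∀ s < τ, φmin ≤ ‖θ s‖ ∧ ‖θ s‖ ≤ φmax) →
          -- every window of `L` consecutive tasks is diverse
          (∀ s, s + L ≤ τ →
            ν ≤ SeqBandit.singularValue r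
              (SeqBandit.windowMatrix θ s L * (SeqBandit.windowMatrix θ s L)ᵀ)) →
        -- independent 1-sub-Gaussian noise
        ∀ (Ω : Type*) [MeasurableSpace Ω] (μ : Measure Ω) [IsProbabilityMeasure μ]
          (η : ℕ → ℕ → Ω → ℝ),
          (∀ s < τ, ∀ t < N, Measurable (η s t)) →
          (∀ s < τ, ∀ t < N, HasSubgaussianMGF (η s t) 1 μ) →
          iIndepFun (fun (p : Fin τ × Fin N) ω => η p.1 p.2 ω) μ →
        ∀ ρ : SeqBandit.Rules d r,
          Integrable (fun ω => SeqBandit.regret ρ L N θ (fun s t => η s t ω) τ) μ ∧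
          ∫ ω, SeqBandit.regret ρ L N θ (fun s t => η s t ω) τ ∂μ ≤
            C * (d * √((τ : ℝ) * r * N) + τ * r * √(N : ℝ)) *
              Real.log ((τ : ℝ) * N) ^ k := by
  refine ⟨1, fun φmin φmax ν c₁ hmin hmm hν hc => ?_⟩
  have hφ : 0 < φmax := hmin.trans_le hmm
  set M₁ : ℝ := 4 * φmax + 16 / φmin + 4 * φmax ^ 2 / φmin with hM₁
  set M₂ : ℝ := 5120 * φmax ^ 2 / (φmin * ν) with hM₂
  have hM₁0 : 0 < M₁ := by positivity
  have hM₂0 : 0 < M₂ := by positivity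
  -- One constant for both kinds of task. The factor `2` comes from `1 ≤ 2ℓ`, which supplies a
  -- logarithm to terms without one; `M₂ * c₁` accounts for `L = c₁ r`.
  set D : ℝ := 2 * M₁ + M₂ + M₂ * c₁ with hD
  have hD0 : 0 < D := by positivity
  refine ⟨D * (2 * √(2 * c₁ + c₁ ^ 2) + 1), by positivity, ?_⟩
  intro d r N τ L hr hdN hrτ hLc B θ hB hθ hnorm hwin Ω _ μ _ η hm hX hind ρ
  have hrd : r ≤ d := by
    simpa using (SeqBandit.orthonormal_colVec hB).linearIndependent.fintype_card_le_finrank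
  have hd : 0 < d := by omega
  have hN : 1 ≤ N := le_trans (Nat.one_le_pow _ _ hd) hdN
  have hlen : SeqBandit.rtLength d N ≤ N := SeqBandit.rtLength_le hdN
  have hlen' : SeqBandit.rtLength r N ≤ N :=
    SeqBandit.rtLength_le ((Nat.pow_le_pow_left hrd 2).trans hdN)
  have hτ : 2 ≤ τ := by have := Nat.one_le_pow 2 r hr; omega
  have hrτ' : r ≤ τ := (Nat.le_self_pow two_ne_zero r).trans hrτ.le
  have hr' : (1 : ℝ) ≤ r := by exact_mod_cast hr
  have hL : 1 ≤ L := by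
    have : (0 : ℝ) < L := by rw [hLc]; positivity
    exact_mod_cast this
  have hN' : (1 : ℝ) ≤ N := by exact_mod_cast hN
  have hτ' : (2 : ℝ) ≤ τ := by exact_mod_cast hτ
  have hs0 : 0 < √(N : ℝ) := Real.sqrt_pos.mpr (by linarith)
  set ℓ := Real.log ((τ : ℝ) * N) with hℓ
  have hℓ1 : 1 ≤ 2 * ℓ := by
    have := Real.log_two_gt_d9
    have := Real.log_le_log (by norm_num) (show (2 : ℝ) ≤ τ * N by nlinarith)
    linarith
  have hℓ0 : 0 ≤ ℓ := by linarith
  set S := Submodule.span ℝ (Set.range (SeqBandit.colVec B)) with hS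
  have hθS : ∀ s < τ, θ s ∈ S := fun s hs => (SeqBandit.mem_span_colVec_iff B _).mpr (hθ s hs)
  have hint : ∀ s ∈ Finset.range τ,
      Integrable (fun ω => SeqBandit.taskRegret ρ L N θ (fun s t => η s t ω) s) μ := fun s hs =>
    SeqBandit.integrable_taskRegret ρ hd hr hN hlen hlen' hm (Finset.mem_range.mp hs)
  have htask : ∀ s ∈ Finset.range τ,
      ∫ ω, SeqBandit.taskRegret ρ L N θ (fun s t => η s t ω) s ∂μ ≤
        D * ℓ * √(N : ℝ) * (d * SeqBandit.taskWeight L s + r) := by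
    intro s hs
    have hs := Finset.mem_range.mp hs
    obtain ⟨h1, h2⟩ := hnorm s hs
    unfold SeqBandit.taskWeight
    split_ifs with hRE
    · have h8 : 8 / φmin ≤ 16 / φmin := by gcongr; norm_num
      have hle : 4 * φmax + 8 / φmin ≤ D * ℓ := by
        have : 0 ≤ 4 * φmax ^ 2 / φmin := by positivity
        have : M₁ * 1 ≤ M₁ * (2 * ℓ) := by gcongr
        nlinarith [mul_nonneg hM₂0.le hℓ0, mul_nonneg (mul_nonneg hM₂0.le hc.le) hℓ0]
      calc _ ≤ (4 * φmax + 8 / φmin) * (d * √(N : ℝ)) :=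
            SeqBandit.integral_taskRegret_le_of_inREPhase ρ hd hr hN hlen hlen' hm hX hind hs hRE
              hmin h1 h2
        _ ≤ D * ℓ * (d * √(N : ℝ)) := by gcongr
        _ ≤ D * ℓ * (d * √(N : ℝ)) + D * ℓ * √(N : ℝ) * r := by
            have : 0 ≤ D * ℓ * √(N : ℝ) * r := by positivity
            linarith
        _ = _ := by ring
    · set w : ℝ := 1 / (SeqBandit.cycleOf L s + 1) with hw
      have hw0 : 0 ≤ w := by positivity
      calc _ ≤ M₁ * (r * √(N : ℝ)) + M₂ * ℓ *
            (√(N : ℝ) * (L + d / (SeqBandit.cycleOf L s + 1))) :=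
            SeqBandit.integral_taskRegret_le_of_not_inREPhase ρ hd hr hN hlen hlen' hm hX hind S
              (SeqBandit.finrank_span_colVec_le B) hθS hν hmin hL hwin hs hRE h1 h2 hτ
        _ = M₁ * 1 * (r * √(N : ℝ)) + M₂ * ℓ * (√(N : ℝ) * (c₁ * r + d * w)) := by
            rw [hLc, hw]; ring
        _ ≤ M₁ * (2 * ℓ) * (r * √(N : ℝ)) + M₂ * ℓ * (√(N : ℝ) * (c₁ * r + d * w)) := by
            gcongr
        _ ≤ M₁ * (2 * ℓ) * (r * √(N : ℝ)) + M₂ * ℓ * (√(N : ℝ) * (c₁ * r + d * w)) +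
            (M₂ * ℓ * √(N : ℝ) * r + (2 * M₁ + M₂ * c₁) * ℓ * √(N : ℝ) * (d * w)) := by
            have : 0 ≤ M₂ * ℓ * √(N : ℝ) * r + (2 * M₁ + M₂ * c₁) * ℓ * √(N : ℝ) * (d * w) := by
              positivity
            linarith
        _ = _ := by rw [hD]; ring
  have hreg : ∀ ω, SeqBandit.regret ρ L N θ (fun s t => η s t ω) τ =
      ∑ s ∈ Finset.range τ, SeqBandit.taskRegret ρ L N θ (fun s t => η s t ω) s := fun ω => rfl
  simp only [hreg]
  refine ⟨integrable_finsetSum _ hint, ?_⟩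
  rw [integral_finsetSum _ hint]
  -- With `L = c₁ r` and `r ≤ τ`, `2τL + L² ≤ (2c₁ + c₁²) τ r`.
  have hweight : ∑ s ∈ Finset.range τ, SeqBandit.taskWeight L s ≤
      2 * √(2 * c₁ + c₁ ^ 2) * √((τ : ℝ) * r) := by
    rw [← abs_of_nonneg (Finset.sum_nonneg fun s _ => SeqBandit.taskWeight_nonneg L s)]
    refine abs_le_of_sq_le_sq ?_ (by positivity)
    rw [mul_pow, mul_pow, Real.sq_sqrt (by positivity), Real.sq_sqrt (by positivity)]
    refine (SeqBandit.sum_taskWeight_sq_le hL (by omega)).trans ?_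
    rw [hLc]
    have hrr : (r : ℝ) * r ≤ τ * r := by gcongr
    nlinarith [mul_le_mul_of_nonneg_left hrr (sq_nonneg c₁)]
  calc _ ≤ ∑ s ∈ Finset.range τ, D * ℓ * √(N : ℝ) * (d * SeqBandit.taskWeight L s + r) :=
        Finset.sum_le_sum htask
    _ = D * ℓ * √(N : ℝ) * (d * ∑ s ∈ Finset.range τ, SeqBandit.taskWeight L s + τ * r) := by
        rw [← Finset.mul_sum, Finset.sum_add_distrib, ← Finset.mul_sum, Finset.sum_const,
          Finset.card_range, nsmul_eq_mul]
    _ ≤ D * ℓ * √(N : ℝ) * (d * (2 * √(2 * c₁ + c₁ ^ 2) * √((τ : ℝ) * r)) + τ * r) := by gcongr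
    -- Nonnegative cross terms are added so that the constant factors out.
    _ ≤ D * ℓ * √(N : ℝ) * (d * (2 * √(2 * c₁ + c₁ ^ 2) * √((τ : ℝ) * r)) + τ * r) +
        D * ℓ * √(N : ℝ) * (d * √((τ : ℝ) * r) + 2 * √(2 * c₁ + c₁ ^ 2) * (τ * r)) := by
        have : 0 ≤ D * ℓ * √(N : ℝ) *
          (d * √((τ : ℝ) * r) + 2 * √(2 * c₁ + c₁ ^ 2) * (τ * r)) := by positivity
        linarith
    _ = D * (2 * √(2 * c₁ + c₁ ^ 2) + 1) *
        (d * (√((τ : ℝ) * r) * √(N : ℝ)) + τ * r * √(N : ℝ)) * ℓ ^ 1 := by ring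
    _ = _ := by rw [← Real.sqrt_mul (by positivity)]
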